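/- Let $\mathcal H=\mathcal H_A\otimes\mathcal H_{\bar A}$ be a finite-dimensional complex Hilbert space, and let $\mathcal H_{code}\subseteq\mathcal H$ be a subspace identified isometrically with a tensor product $\mathcal H_a\otimes\mathcal H_{\bar a}$ of nonzero Hilbert spaces. Write $|S|=\dim\mathcal H_S$, and assume $|a|\le|A|$ and $|\bar a|\le|\bar A|$. Let $|\tilde i\rangle_a$ and $|\tilde j\rangle_{\bar a}$ be orthonormal bases of $\mathcal H_a$ and $\mathcal H_{\bar a}$, and $|\widetilde{ij}\rangle=|\tilde i\rangle_a|\tilde j\rangle_{\bar a}\in\mathcal H_{code}$. Then there are orthogonal decompositions $\mathcal H_A=(\mathcal H_{A_1}\otimes\mathcal H_{A_2})\oplus\mathcal H_{A_3}$ and $\mathcal H_{\bar A}=(\mathcal H_{\bar A_1}\otimes\mathcal H_{\bar A_2})\oplus\mathcal H_{\bar A_3}$ with $|A_1|=|a|$, $|A_3|<|a|$, $|\bar A_1|=|\bar a|$, $|\bar A_3|<|\bar a|$. For every such pair of decompositions, with orthonormal bases $|i\rangle_{A_1}$ of $\mathcal H_{A_1}$ and $|j\rangle_{\bar A_1}$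 of $\mathcal H_{\bar A_1}$, the following statements are equivalent. 1. There are a unitary $U_A$ on $\mathcal H_A$ and orthonormal vectors $|\chi_j\rangle\in\mathcal H_{A_2}\otimes\mathcal H_{\bar A}$ such that $|\widetilde{ij}\rangle=U_A\big(|i\rangle_{A_1}|\chi_j\rangle_{A_2\bar A}\big)$ for all $i,j$; and there are a unitary $U_{\bar A}$ on $\mathcal H_{\bar A}$ and orthonormal vectors $|\bar\chi_i\rangle\in\mathcal H_{\bar A_2}\otimes\mathcal H_A$ such that $|\widetilde{ij}\rangle=U_{\bar A}\big(|j\rangle_{\bar A_1}|\bar\chi_i\rangle_{\bar A_2A}\big)$ for all $i,j$. 2. There are real constants $\mathcal L_A=\mathcal L_{\bar A}$ such that every density operator $\tilde\rho$ on $\mathcal H_{code}$ satisfies $$S(\tilde\rho_A)=\mathcal L_A+S(\tilde\rho_a),\qquad S(\tilde\rho_{\bar A})=\mathcal L_{\bar A}+S(\tilde\rho_{\bar a}),$$ where $\tilde\rho_A=\mathrm{Tr}_{\bar A}\tilde\rho$, $\tilde\rho_{\bar A}=\mathrm{Tr}_A\tilde\rho$, $\tilde\rho_a=\mathrm{Tr}_{\bar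 a}\tilde\rho$, $\tilde\rho_{\bar a}=\mathrm{Tr}_a\tilde\rho$, and $S(\rho)=-\mathrm{Tr}\,\rho\log\rho$. 2′. For every orthonormal basis $|e_i\rangle$ of $\mathcal H_a$ and every orthonormal basis $|f_j\rangle$ of $\mathcal H_{\bar a}$ there are real constants $\mathcal L_A=\mathcal L_{\bar A}$ such that the two formulas of 2 hold for all $\tilde\rho=\sum_{i,j}p_{ij}|e_if_j\rangle\langle e_if_j|$ with $p_{ij}\ge0$ and $\sum_{i,j}p_{ij}=1$. 3. For all density operators $\tilde\rho,\tilde\sigma$ on $\mathcal H_{code}$, $S(\tilde\rho_A|\tilde\sigma_A)=S(\tilde\rho_a|\tilde\sigma_a)$ and $S(\tilde\rho_{\bar A}|\tilde\sigma_{\bar A})=S(\tilde\rho_{\bar a}|\tilde\sigma_{\bar a})$. Here $S(\rho|\sigma)=\mathrm{Tr}\,\rho\log\rho-\mathrm{Tr}\,\rho\log\sigma$ if the support of $\rho$ is contained in that of $\sigma$, and $S(\rho|\sigma)=+\infty$ otherwise. 4. For all $|\tilde\phi\rangle\in\mathcal H_{code}$, $\langle\tilde\phi|[\tilde O_a,X_{\bar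 A}]|\tilde\phi\rangle=0$ for all operators $\tilde O_a$ on $\mathcal H_a$ and $X_{\bar A}$ on $\mathcal H_{\bar A}$, and $\langle\tilde\phi|[\tilde O_{\bar a},X_A]|\tilde\phi\rangle=0$ for all operators $\tilde O_{\bar a}$ on $\mathcal H_{\bar a}$ and $X_A$ on $\mathcal H_A$. (Operators on $\mathcal H_{code}$ are extended to $\mathcal H$ by zero on $\mathcal H_{code}^\perp$.) 5. For every operator $\tilde O_a$ on $\mathcal H_a$ there is an operator $O_A$ on $\mathcal H_A$ that acts as $\tilde O_a$ on code kets and code bras, i.e. $O_A|\tilde\psi\rangle=\tilde O_a|\tilde\psi\rangle$ and $O_A^\dagger|\tilde\psi\rangle=\tilde O_a^\dagger|\tilde\psi\rangle$ for all $|\tilde\psi\rangle\in\mathcal H_{code}$; and likewise for every operator $\tilde O_{\bar a}$ on $\mathcal H_{\bar a}$ there is such an operator $O_{\bar A}$ on $\mathcal H_{\bar A}$. -/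

import Mathlib

open scoped Matrix Kronecker ComplexOrder

noncomputable section

namespace Reconstruction

/-! Finite-dimensional Hilbert spaces are `ℂ ^ n` for a finite index type `n` of an orthonormal
basis; operators are square matrices, and `ℂ ^ A ⊗ ℂ ^ B = ℂ ^ (A × B)`.  Here `A`, `B` label the
physical factors (`B` is the complement of `A`) and `a`, `b` the logical ones. -/

/-- Density matrices: positive semidefinite of trace one. -/
def IsDensity {n : Type*} [Fintype n] (ρ : Matrix n n ℂ) : Prop :=
  ρ.PosSemidef ∧ ρ.trace = 1

/-- Partial trace over the second factor. -/
def traceRight {m n : Type*} [Fintype n] (M : Matrix (m × n) (m × n) ℂ) : Matrix m m ℂ :=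
  fun i i' => ∑ j, M (i, j) (i', j)

/-- Partial trace over the first factor. -/
def traceLeft {m n : Type*} [Fintype m] (M : Matrix (m × n) (m × n) ℂ) : Matrix n n ℂ :=
  fun j j' => ∑ i, M (i, j) (i, j')

/-- The logarithm of a Hermitian matrix by functional calculus (the kernel is sent to `0`). -/
def matrixLog {n : Type*} [Fintype n] [DecidableEq n] (ρ : Matrix n n ℂ) : Matrix n n ℂ :=
  cfc Real.log ρ

/-- Von Neumann entropy `S(ρ) = - Tr (ρ log ρ)`. -/
def vonNeumannEntropy {n : Type*} [Fintype n] [DecidableEq n] (ρ : Matrix n n ℂ) : ℝ :=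
  -(ρ * matrixLog ρ).trace.re

open Classical in
/-- Relative entropy `S(ρ|σ) = Tr (ρ log ρ) - Tr (ρ log σ)` if the support of `ρ` is contained in
the support of `σ` (that is, `ker σ ⊆ ker ρ`), and `+∞` otherwise. -/
def relativeEntropy {n : Type*} [Fintype n] [DecidableEq n] (ρ σ : Matrix n n ℂ) : EReal :=
  if ∀ v : n → ℂ, σ *ᵥ v = 0 → ρ *ᵥ v = 0 then
    (((ρ * matrixLog ρ).trace.re - (ρ * matrixLog σ).trace.re : ℝ) : EReal)
  else ⊤

section Code

variable {A B a b : Type*} [Fintype A] [Fintype B] [Fintype a] [Fintype b]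
  [DecidableEq A] [DecidableEq B] [DecidableEq a] [DecidableEq b]

/-- The identification of `ℂ ^ a ⊗ ℂ ^ b` with the code subspace of `ℂ ^ A ⊗ ℂ ^ B`: an isometry,
whose column with label `(i, j)` is the code basis vector `|ij⟩`. -/
def IsCode (V : Matrix (A × B) (a × b) ℂ) : Prop :=
  Vᴴ * V = 1

/-- The code subspace. -/
def codeSpace (V : Matrix (A × B) (a × b) ℂ) : Submodule ℂ (A × B → ℂ) :=
  LinearMap.range V.mulVecLin

/-- An operator on the code subspace, seen as an operator on the physical space that vanishes on
the orthogonal complement of the code subspace. -/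
def logical (V : Matrix (A × B) (a × b) ℂ) (O : Matrix (a × b) (a × b) ℂ) :
    Matrix (A × B) (A × B) ℂ :=
  V * O * Vᴴ

/-- An orthogonal decomposition `H_S = (H_{S₁} ⊗ H_{S₂}) ⊕ H_{S₃}` with `dim H_{S₁} = |s|`,
`dim H_{S₂} = m`, `dim H_{S₃} = r` and `r < |s|`, given by a unitary matrix.
The orthonormal basis of `H_{S₁}` is labelled by `s`. -/
def IsDecomposition {S s : Type*} [Fintype S] [Fintype s] [DecidableEq S] [DecidableEq s]
    {m r : ℕ} (D : Matrix S ((s × Fin m) ⊕ Fin r) ℂ) : Prop :=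
  Dᴴ * D = 1 ∧ D * Dᴴ = 1 ∧ r < Fintype.card s

/-- The vector `|i⟩_{A₁} |χ⟩_{A₂ B}` of `H_A ⊗ H_B`. -/
def placeLeft {m r : ℕ} (D : Matrix A ((a × Fin m) ⊕ Fin r) ℂ) (i : a)
    (χ : EuclideanSpace ℂ (Fin m × B)) : A × B → ℂ :=
  fun x => ∑ k, D x.1 (Sum.inl (i, k)) * χ (k, x.2)

/-- The vector `|j⟩_{B₁} |χ⟩_{B₂ A}` of `H_A ⊗ H_B`. -/
def placeRight {m r : ℕ} (D : Matrix B ((b × Fin m) ⊕ Fin r) ℂ) (j : b)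
    (χ : EuclideanSpace ℂ (Fin m × A)) : A × B → ℂ :=
  fun x => ∑ k, D x.2 (Sum.inl (j, k)) * χ (k, x.1)

/-- `|ij⟩ = U_A (|i⟩_{A₁} |χ_j⟩_{A₂ B})` and `|ij⟩ = U_B (|j⟩_{B₁} |χ'_i⟩_{B₂ A})`, for some
unitary `U_A` on `H_A` and `U_B` on `H_B` and some orthonormal families `χ`, `χ'`. -/
def BasisFactorization (V : Matrix (A × B) (a × b) ℂ)
    {mA rA : ℕ} (DA : Matrix A ((a × Fin mA) ⊕ Fin rA) ℂ)
    {mB rB : ℕ} (DB : Matrix B ((b × Fin mB) ⊕ Fin rB) ℂ) : Prop :=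
  (∃ UA ∈ Matrix.unitaryGroup A ℂ, ∃ χ : b → EuclideanSpace ℂ (Fin mA × B),
    Orthonormal ℂ χ ∧
    ∀ i j, V.col (i, j) = (UA ⊗ₖ (1 : Matrix B B ℂ)) *ᵥ placeLeft DA i (χ j)) ∧
  (∃ UB ∈ Matrix.unitaryGroup B ℂ, ∃ χ' : a → EuclideanSpace ℂ (Fin mB × A),
    Orthonormal ℂ χ' ∧
    ∀ i j, V.col (i, j) = ((1 : Matrix A A ℂ) ⊗ₖ UB) *ᵥ placeRight DB j (χ' i))

/-- The two entropy formulas for a state `ρ` of the code, with constants `LA` and `LB`. -/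
def EntropyFormulas (V : Matrix (A × B) (a × b) ℂ) (LA LB : ℝ)
    (ρ : Matrix (a × b) (a × b) ℂ) : Prop :=
  vonNeumannEntropy (traceRight (V * ρ * Vᴴ)) = LA + vonNeumannEntropy (traceRight ρ) ∧
  vonNeumannEntropy (traceLeft (V * ρ * Vᴴ)) = LB + vonNeumannEntropy (traceLeft ρ)

/-- The entropy formulas with equal constants, for all density matrices of the code. -/
def EntropyFormula (V : Matrix (A × B) (a × b) ℂ) : Prop :=
  ∃ LA LB : ℝ, (∀ ρ : Matrix (a × b) (a × b) ℂ, IsDensity ρ → EntropyFormulas V LA LB ρ) ∧ LA = LB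

/-- For every choice of orthonormal bases of `H_a` and `H_b` (the columns of the unitaries `u` and
`w`), the entropy formulas with equal constants for all states
`∑ i j, p i j |ij⟩⟨ij|` that are diagonal in the resulting product basis. -/
def DiagonalEntropyFormula (V : Matrix (A × B) (a × b) ℂ) : Prop :=
  ∀ u ∈ Matrix.unitaryGroup a ℂ, ∀ w ∈ Matrix.unitaryGroup b ℂ,
    ∃ LA LB : ℝ,
      (∀ p : a × b → ℝ, (∀ x, 0 ≤ p x) → ∑ x, p x = 1 →
        EntropyFormulas V LA LB
          ((u ⊗ₖ w) * Matrix.diagonal (fun x => (p x : ℂ)) * (u ⊗ₖ w)ᴴ)) ∧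
      LA = LB

/-- Equality of physical and logical relative entropies, on both sides. -/
def RelativeEntropyEquality (V : Matrix (A × B) (a × b) ℂ) : Prop :=
  ∀ ρ σ : Matrix (a × b) (a × b) ℂ, IsDensity ρ → IsDensity σ →
    relativeEntropy (traceRight (V * ρ * Vᴴ)) (traceRight (V * σ * Vᴴ)) =
      relativeEntropy (traceRight ρ) (traceRight σ) ∧
    relativeEntropy (traceLeft (V * ρ * Vᴴ)) (traceLeft (V * σ * Vᴴ)) =
      relativeEntropy (traceLeft ρ) (traceLeft σ)

/-- `⟨φ|[O_a, X_B]|φ⟩ = 0` and `⟨φ|[O_b, X_A]|φ⟩ = 0` for all `φ` in the code subspace. -/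
def VanishingCommutators (V : Matrix (A × B) (a × b) ℂ) : Prop :=
  ∀ φ ∈ codeSpace V,
    (∀ (O : Matrix a a ℂ) (X : Matrix B B ℂ),
      star φ ⬝ᵥ (⁅logical V (O ⊗ₖ (1 : Matrix b b ℂ)), (1 : Matrix A A ℂ) ⊗ₖ X⁆ *ᵥ φ) = 0) ∧
    (∀ (O : Matrix b b ℂ) (X : Matrix A A ℂ),
      star φ ⬝ᵥ (⁅logical V ((1 : Matrix a a ℂ) ⊗ₖ O), X ⊗ₖ (1 : Matrix B B ℂ)⁆ *ᵥ φ) = 0)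

/-- Every operator `O` on `H_a` (on `H_b`) has a representative `OA` on `H_A` (`OB` on `H_B`) which
acts on the code subspace as `O`, and whose adjoint acts there as the adjoint of `O`; that is, the
two operators agree on code kets and on code bras. -/
def OperatorReconstruction (V : Matrix (A × B) (a × b) ℂ) : Prop :=
  (∀ O : Matrix a a ℂ, ∃ OA : Matrix A A ℂ, ∀ ψ ∈ codeSpace V,
    (OA ⊗ₖ (1 : Matrix B B ℂ)) *ᵥ ψ = logical V (O ⊗ₖ (1 : Matrix b b ℂ)) *ᵥ ψ ∧
    (OAᴴ ⊗ₖ (1 : Matrix B B ℂ)) *ᵥ ψ = logical V (Oᴴ ⊗ₖ (1 : Matrix b b ℂ)) *ᵥ ψ) ∧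
  (∀ O : Matrix b b ℂ, ∃ OB : Matrix B B ℂ, ∀ ψ ∈ codeSpace V,
    ((1 : Matrix A A ℂ) ⊗ₖ OB) *ᵥ ψ = logical V ((1 : Matrix a a ℂ) ⊗ₖ O) *ᵥ ψ ∧
    ((1 : Matrix A A ℂ) ⊗ₖ OBᴴ) *ᵥ ψ = logical V ((1 : Matrix a a ℂ) ⊗ₖ Oᴴ) *ᵥ ψ)

end Code

end Reconstruction

end

open Reconstruction

/-! The pivot is `Decoupled`. Cut the code isometry `V` into slices `V_i : H_B ⊗ H_b → H_A`, one for
each logical label `i` of `a`; decoupling says `V_iᴴ V_i' = δ_ii' G` with one common `G`. Matrices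
with equal Gram matrices differ by an isometry on the left, so `V_i = E_i C`, where the isometries
`E_i` have mutually orthogonal ranges (`Decoupled.exists_isOrthogonalIsometries`). The condition on
the remainder dimension makes these ranges fit into any admissible decomposition, and this is the
`A`-half of the basis factorization (`Decoupled.leftFactorization`). The `B`-half is the same
statement for `swapFactors V`.

The two halves together give a product form `V = (E ⊗ F)(· ⊗ X)` with local isometries `E`, `F` and
a fixed vector `X` (`IsOrthogonalIsometries.exists_isProductForm`). The reduced state on `A` is then
`E (ρ_a ⊗ X Xᴴ) Eᴴ`. Hence entropy shifts by the entropy of `X Xᴴ`, and relative entropy does not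
change. The two shifts agree because they are entropies of the two marginals of one pure vector.

Each entropic condition leads back to decoupling. The states `|ef⟩` and `|e'f⟩` look the same on
`b`. The equality case of Klein's inequality (`klein`), or strict concavity of the entropy, then
shows that they look the same on `B`. Polarization in `e` and then in `f` gives decoupling
(`EnvironmentBlind.decoupled`). For operators, reconstruction implies vanishing commutators because
operators on `A` and `B` commute, and testing the commutators on matrix units gives decoupling. -/

noncomputable section

namespace Reconstruction

/-! ### Functional calculus, entropy and Klein's inequality. -/

section Spectral

open Polynomial

variable {m n : Type*} [Fintype m] [Fintype n] [DecidableEq m] [DecidableEq n]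

theorem cfc_eq_aeval {M : Matrix n n ℂ} (hM : M.IsHermitian) {f : ℝ → ℝ} {p : ℝ[X]}
    (h : ∀ x ∈ spectrum ℝ M, f x = p.eval x) : cfc f M = aeval M p := by
  rw [cfc_congr (g := p.eval) h]
  exact cfc_polynomial p M hM.isSelfAdjoint

/-- A function vanishing at `0` acts on two Hermitian matrices as a common polynomial without
constant term. -/
theorem exists_common_polynomial {M : Matrix m m ℂ} {N : Matrix n n ℂ} (hM : M.IsHermitian)
    (hN : N.IsHermitian) {f : ℝ → ℝ} (hf : f 0 = 0) :
    ∃ q : ℝ[X], cfc f M = aeval M q * M ∧ cfc f N = aeval N q * N := by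
  classical
  have hs : (spectrum ℝ M ∪ spectrum ℝ N ∪ {0}).Finite :=
    ((M.finite_real_spectrum).union N.finite_real_spectrum).union (Set.finite_singleton 0)
  have hp : ∀ x ∈ spectrum ℝ M ∪ spectrum ℝ N ∪ {0},
      (Lagrange.interpolate hs.toFinset id f).eval x = f x := fun x hx =>
    Lagrange.eval_interpolate_at_node f Function.injective_id.injOn (hs.mem_toFinset.2 hx)
  -- `0` is among the nodes so that the interpolant vanishes there and is divisible by `X`.
  obtain ⟨q, hq⟩ : X ∣ Lagrange.interpolate hs.toFinset id f := by
    rw [X_dvd_iff, coeff_zero_eq_eval_zero, hp 0 (by simp), hf]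
  refine ⟨q, ?_, ?_⟩
  · rw [cfc_eq_aeval hM (p := X * q) fun x hx => by rw [← hq, hp x (by simp [hx])], mul_comm,
      map_mul, aeval_X]
  · rw [cfc_eq_aeval hN (p := X * q) fun x hx => by rw [← hq, hp x (by simp [hx])], mul_comm,
      map_mul, aeval_X]

/-- Powers slide across `E` one factor at a time. Since `E` may be rectangular, this compares
functional calculi in different dimensions. -/
theorem aeval_mul_intertwine {M : Matrix m m ℂ} {N : Matrix n n ℂ} {E : Matrix m n ℂ}
    (h : M * E = E * N) (q : ℝ[X]) : aeval M q * E = E * aeval N q := by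
  induction q using Polynomial.induction_on' with
  | add p q hp hq => simp [Matrix.add_mul, Matrix.mul_add, hp, hq]
  | monomial k c =>
    have hk : ∀ k : ℕ, M ^ k * E = E * N ^ k := fun k => by
      induction k with
      | zero => simp
      | succ k ih => rw [pow_succ, pow_succ', Matrix.mul_assoc, h, ← Matrix.mul_assoc, ih,
          Matrix.mul_assoc, ← pow_succ, ← pow_succ']
    simp [aeval_monomial, Algebra.algebraMap_eq_smul_one, hk]

theorem transpose_aeval (M : Matrix n n ℂ) (q : ℝ[X]) : (aeval M q)ᵀ = aeval Mᵀ q := by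
  induction q using Polynomial.induction_on' with
  | add p q hp hq => simp [hp, hq]
  | monomial k c => simp [aeval_monomial, Algebra.algebraMap_eq_smul_one, Matrix.transpose_pow]

/-- Since `Real.log 0 = 0`, the logarithm is a polynomial without constant term, so it produces
nothing outside the range of `E`. -/
theorem matrixLog_isometry {M : Matrix n n ℂ} (hM : M.IsHermitian) {E : Matrix m n ℂ}
    (hE : Eᴴ * E = 1) : matrixLog (E * M * Eᴴ) = E * matrixLog M * Eᴴ := by
  obtain ⟨q, h₁, h₂⟩ := exists_common_polynomial hM
    (Matrix.isHermitian_mul_mul_conjTranspose E hM) Real.log_zero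
  have h : E * M * Eᴴ * E = E * M := by rw [Matrix.mul_assoc, hE, Matrix.mul_one]
  rw [matrixLog, matrixLog, h₁, h₂, ← Matrix.mul_assoc, ← Matrix.mul_assoc,
    aeval_mul_intertwine h, ← Matrix.mul_assoc]

theorem matrixLog_diagonal (d : n → ℝ) :
    matrixLog (Matrix.diagonal fun i => (d i : ℂ)) =
      Matrix.diagonal fun i => (Real.log (d i) : ℂ) := by
  classical
  have hM : (Matrix.diagonal fun i => (d i : ℂ)).IsHermitian := by
    simp [Matrix.IsHermitian, Matrix.diagonal_conjTranspose, Pi.star_def]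
  -- Interpolating at the diagonal entries as well as on the spectrum avoids having to identify the
  -- two sets.
  have hp : ∀ x ∈ spectrum ℝ (Matrix.diagonal fun i => (d i : ℂ)) ∪ Set.range d,
      Real.log x = (Lagrange.interpolate
        ((Matrix.finite_real_spectrum (A := Matrix.diagonal fun i => (d i : ℂ))).union
          (Set.finite_range d)).toFinset id Real.log).eval x := fun x hx =>
    (Lagrange.eval_interpolate_at_node _ Function.injective_id.injOn
      ((Set.Finite.mem_toFinset _).2 hx)).symm
  rw [matrixLog, cfc_eq_aeval hM fun x hx => hp x (.inl hx)]
  have : Matrix.diagonal (fun i => (d i : ℂ)) = Matrix.diagonalAlgHom ℝ (fun i => (d i : ℂ)) := rfl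
  rw [this, aeval_algHom_apply]
  simp only [Matrix.diagonalAlgHom_apply]
  congr 1
  ext i
  rw [hp (d i) (.inr ⟨i, rfl⟩), Polynomial.aeval_pi_apply]
  exact Polynomial.aeval_algebraMap_apply ℂ (d i) _

theorem matrixLog_spectral {U : Matrix n n ℂ} (hU : Uᴴ * U = 1) (d : n → ℝ) :
    matrixLog (U * (Matrix.diagonal fun i => (d i : ℂ)) * Uᴴ) =
      U * (Matrix.diagonal fun i => (Real.log (d i) : ℂ)) * Uᴴ := by
  rw [matrixLog_isometry _ hU, matrixLog_diagonal]
  simp [Matrix.IsHermitian, Matrix.diagonal_conjTranspose, Pi.star_def]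

theorem exists_spectral {M : Matrix n n ℂ} (hM : M.IsHermitian) :
    ∃ (U : Matrix n n ℂ) (d : n → ℝ), Uᴴ * U = 1 ∧ U * Uᴴ = 1 ∧
      M = U * (Matrix.diagonal fun i => (d i : ℂ)) * Uᴴ :=
  ⟨hM.eigenvectorUnitary, hM.eigenvalues, Unitary.coe_star_mul_self _,
    Unitary.coe_mul_star_self _, hM.spectral_theorem⟩

theorem exists_spectral_nonneg {M : Matrix n n ℂ} (hM : M.PosSemidef) :
    ∃ (U : Matrix n n ℂ) (d : n → ℝ), Uᴴ * U = 1 ∧ U * Uᴴ = 1 ∧ (∀ i, 0 ≤ d i) ∧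
      M = U * (Matrix.diagonal fun i => (d i : ℂ)) * Uᴴ :=
  ⟨hM.1.eigenvectorUnitary, hM.1.eigenvalues, Unitary.coe_star_mul_self _,
    Unitary.coe_mul_star_self _, hM.eigenvalues_nonneg, hM.1.spectral_theorem⟩

theorem mul_mul_conjTranspose_sandwich {U : Matrix n n ℂ} (hU : Uᴴ * U = 1) (D : Matrix n n ℂ) :
    Uᴴ * (U * D * Uᴴ) * U = D := by
  simp only [Matrix.mul_assoc, hU, Matrix.mul_one]
  rw [← Matrix.mul_assoc, hU, Matrix.one_mul]

theorem trace_mul_conj_diagonal (M U : Matrix n n ℂ) (d : n → ℂ) :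
    (M * (U * Matrix.diagonal d * Uᴴ)).trace = ∑ i, (Uᴴ * M * U) i i * d i := by
  rw [← Matrix.mul_assoc, Matrix.trace_mul_comm, ← Matrix.mul_assoc, ← Matrix.mul_assoc]
  simp [Matrix.trace, Matrix.mul_diagonal]

/-- The columns of `U` with eigenvalue zero lie in the smaller kernel, so `M` kills them. -/
theorem diag_eq_zero_of_ker_le {M U : Matrix n n ℂ} {d : n → ℝ} (hU : Uᴴ * U = 1)
    (h : ∀ v, (U * (Matrix.diagonal fun i => (d i : ℂ)) * Uᴴ) *ᵥ v = 0 → M *ᵥ v = 0)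
    {i : n} (hi : d i = 0) (k : n) : (M * U) k i = 0 := by
  have h₁ := h (U.col i) (by
    ext k
    have : (U * (Matrix.diagonal fun i => (d i : ℂ)) * Uᴴ) *ᵥ U.col i =
        (U * (Matrix.diagonal fun i => (d i : ℂ)) * Uᴴ * U).col i := by
      ext; simp [Matrix.mulVec, dotProduct, Matrix.mul_apply]
    rw [this, Matrix.mul_assoc, hU, Matrix.mul_one]
    simp [Matrix.mul_diagonal, hi])
  simpa [Matrix.mulVec, dotProduct, Matrix.mul_apply] using congrFun h₁ k

/-- In joint eigenbases this is `log (s w) = log s + log w`. The rule fails at zero eigenvalues, but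
where `s = 0` the support hypothesis makes the weight of `ρ` vanish, and where `w = 0` the weight of
`ω` vanishes. -/
theorem trace_mul_matrixLog_kronecker {ρ σ : Matrix m m ℂ} {ω : Matrix n n ℂ}
    (hσ : σ.IsHermitian) (hω : ω.IsHermitian) (h : ∀ v, σ *ᵥ v = 0 → ρ *ᵥ v = 0) :
    ((ρ ⊗ₖ ω) * matrixLog (σ ⊗ₖ ω)).trace =
      (ρ * matrixLog σ).trace * ω.trace + ρ.trace * (ω * matrixLog ω).trace := by
  obtain ⟨U, s, hU, hU', rfl⟩ := exists_spectral hσ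
  obtain ⟨W, w, hW, hW', rfl⟩ := exists_spectral hω
  have hUW : (U ⊗ₖ W)ᴴ * (U ⊗ₖ W) = 1 := by
    rw [Matrix.conjTranspose_kronecker, ← Matrix.mul_kronecker_mul, hU, hW,
      Matrix.one_kronecker_one]
  have hk : (U * (Matrix.diagonal fun i => (s i : ℂ)) * Uᴴ) ⊗ₖ
      (W * (Matrix.diagonal fun i => (w i : ℂ)) * Wᴴ) =
      (U ⊗ₖ W) * (Matrix.diagonal fun x : m × n => ((s x.1 * w x.2 : ℝ) : ℂ)) * (U ⊗ₖ W)ᴴ := by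
    rw [Matrix.mul_kronecker_mul, Matrix.mul_kronecker_mul, Matrix.conjTranspose_kronecker,
      Matrix.diagonal_kronecker_diagonal]
    simp
  have hρ : ρ.trace = ∑ i, (Uᴴ * ρ * U) i i := by
    rw [← Matrix.mul_one ρ, ← hU', ← Matrix.mul_assoc, Matrix.trace_mul_comm, ← Matrix.mul_assoc]
    simp [Matrix.trace, Matrix.mul_assoc, hU']
  rw [hk, matrixLog_spectral hUW, matrixLog_spectral hU, matrixLog_spectral hW,
    trace_mul_conj_diagonal, trace_mul_conj_diagonal, trace_mul_conj_diagonal,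
    mul_mul_conjTranspose_sandwich hW, Matrix.conjTranspose_kronecker, ← Matrix.mul_kronecker_mul,
    ← Matrix.mul_kronecker_mul, mul_mul_conjTranspose_sandwich hW, hρ, Matrix.trace_mul_comm,
    ← Matrix.mul_assoc, hW, Matrix.one_mul, Matrix.trace_diagonal, Finset.sum_mul_sum,
    Finset.sum_mul_sum, ← Finset.sum_add_distrib, Fintype.sum_prod_type]
  refine Finset.sum_congr rfl fun i _ => ?_
  rw [← Finset.sum_add_distrib]
  refine Finset.sum_congr rfl fun j _ => ?_
  simp only [Matrix.kroneckerMap_apply, Matrix.diagonal_apply_eq]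
  by_cases hs : s i = 0
  · have : (Uᴴ * ρ * U) i i = 0 := by
      rw [Matrix.mul_assoc, Matrix.mul_apply]
      exact Finset.sum_eq_zero fun k _ => by rw [diag_eq_zero_of_ker_le hU h hs k, mul_zero]
    simp [this]
  by_cases hw : w j = 0
  · simp [hw]
  rw [Real.log_mul hs hw]
  push_cast
  ring

theorem vonNeumannEntropy_isometry {M : Matrix n n ℂ} (hM : M.IsHermitian) {E : Matrix m n ℂ}
    (hE : Eᴴ * E = 1) : vonNeumannEntropy (E * M * Eᴴ) = vonNeumannEntropy M := by
  rw [vonNeumannEntropy, vonNeumannEntropy, matrixLog_isometry hM hE, Matrix.trace_mul_comm]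
  simp only [Matrix.mul_assoc]
  rw [← Matrix.mul_assoc Eᴴ, hE, Matrix.one_mul, ← Matrix.mul_assoc, ← Matrix.mul_assoc,
    Matrix.trace_mul_comm, ← Matrix.mul_assoc, ← Matrix.mul_assoc, hE, Matrix.one_mul,
    Matrix.trace_mul_comm]

theorem vonNeumannEntropy_kronecker {ρ : Matrix m m ℂ} {ω : Matrix n n ℂ} (hρ : ρ.IsHermitian)
    (hω : ω.IsHermitian) (hρ₁ : ρ.trace = 1) (hω₁ : ω.trace = 1) :
    vonNeumannEntropy (ρ ⊗ₖ ω) = vonNeumannEntropy ω + vonNeumannEntropy ρ := by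
  rw [vonNeumannEntropy, trace_mul_matrixLog_kronecker hρ hω fun _ h => h, hρ₁, hω₁]
  simp [vonNeumannEntropy]

/-- The two products have the same nonzero spectrum. Here one polynomial serves both, and `X`
intertwines them. -/
theorem vonNeumannEntropy_mul_conjTranspose (X : Matrix m n ℂ) :
    vonNeumannEntropy (X * Xᴴ) = vonNeumannEntropy (Xᴴ * X) := by
  obtain ⟨q, h₁, h₂⟩ := exists_common_polynomial (Matrix.isHermitian_mul_conjTranspose_self X)
    (Matrix.isHermitian_conjTranspose_mul_self X) Real.log_zero
  rw [vonNeumannEntropy, vonNeumannEntropy, matrixLog, matrixLog, h₁, h₂,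
    ← Matrix.mul_assoc (aeval (X * Xᴴ) q), aeval_mul_intertwine (N := Xᴴ * X)
      (Matrix.mul_assoc X Xᴴ X), Matrix.mul_assoc, Matrix.trace_mul_comm X]
  simp only [Matrix.mul_assoc]

theorem vonNeumannEntropy_transpose {M : Matrix n n ℂ} (hM : M.IsHermitian) :
    vonNeumannEntropy Mᵀ = vonNeumannEntropy M := by
  obtain ⟨q, h₁, h₂⟩ := exists_common_polynomial hM hM.transpose Real.log_zero
  rw [vonNeumannEntropy, vonNeumannEntropy, matrixLog, matrixLog, h₁, h₂, ← transpose_aeval,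
    ← Matrix.trace_transpose]
  simp [Matrix.transpose_mul, Matrix.mul_assoc]

/-- For `p > 0` this is `log x ≤ x - 1` at `x = q / p`, strict away from `x = 1`. For `p = 0` the
expression is just `q`. -/
theorem klein_scalar {p q : ℝ} (hp : 0 ≤ p) (hq : 0 < q) :
    0 ≤ p * Real.log p - p * Real.log q - p + q ∧
      (p * Real.log p - p * Real.log q - p + q = 0 → p = q) := by
  rcases hp.eq_or_lt with rfl | hp
  · simp [hq.le, eq_comm]
  have key : p * Real.log p - p * Real.log q - p + q =
      p * ((q / p - 1) - Real.log (q / p)) := by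
    rw [Real.log_div hq.ne' hp.ne']
    field_simp
    ring
  rw [key]
  have hqp : 0 < q / p := div_pos hq hp
  refine ⟨mul_nonneg hp.le (sub_nonneg.2 (Real.log_le_sub_one_of_pos hqp)), fun h => ?_⟩
  by_contra hne
  have h₁ := Real.log_lt_sub_one_of_pos hqp (by
    rw [Ne, div_eq_one_iff_eq hp.ne']; exact fun h => hne h.symm)
  rcases mul_eq_zero.1 h with h | h <;> linarith

/-- **Klein's inequality**, with the case of equality. -/
theorem klein {ρ σ : Matrix n n ℂ} (hρ : ρ.PosSemidef) (hσ : σ.PosSemidef)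
    (ht : ρ.trace = σ.trace) (h : ∀ v, σ *ᵥ v = 0 → ρ *ᵥ v = 0) :
    0 ≤ (ρ * matrixLog ρ).trace.re - (ρ * matrixLog σ).trace.re ∧
      ((ρ * matrixLog ρ).trace.re - (ρ * matrixLog σ).trace.re = 0 → ρ = σ) := by
  obtain ⟨U, p, hU, hU', hp, rfl⟩ := exists_spectral_nonneg hρ
  obtain ⟨W, q, hW, hW', hq, rfl⟩ := exists_spectral_nonneg hσ
  -- The overlaps of the two eigenbases: their squared moduli form a doubly stochastic matrix, which
  -- turns both traces into sums over pairs of eigenvalues.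
  set T : Matrix n n ℂ := Uᴴ * W with hT
  have hTT : Tᴴ * T = 1 := by
    simp only [hT, Matrix.conjTranspose_mul, Matrix.conjTranspose_conjTranspose, Matrix.mul_assoc]
    rw [← Matrix.mul_assoc U, hU', Matrix.one_mul, hW]
  have hTT' : T * Tᴴ = 1 := mul_eq_one_comm.1 hTT
  have hrow : ∀ i, ∑ j, Complex.normSq (T i j) = 1 := fun i => by
    have := congrFun (congrFun hTT' i) i
    simp only [Matrix.mul_apply, Matrix.conjTranspose_apply, Matrix.one_apply_eq] at this
    rw [← Complex.ofReal_inj, Complex.ofReal_one, ← this, Complex.ofReal_sum]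
    exact Finset.sum_congr rfl fun j _ => (Complex.mul_conj _).symm
  have hcol : ∀ j, ∑ i, Complex.normSq (T i j) = 1 := fun j => by
    have := congrFun (congrFun hTT j) j
    simp only [Matrix.mul_apply, Matrix.conjTranspose_apply, Matrix.one_apply_eq] at this
    rw [← Complex.ofReal_inj, Complex.ofReal_one, ← this, Complex.ofReal_sum]
    exact Finset.sum_congr rfl fun i _ => Complex.normSq_eq_conj_mul_self
  have hdiag : ∀ j, (Wᴴ * (U * (Matrix.diagonal fun i => (p i : ℂ)) * Uᴴ) * W) j j =
      ((∑ i, Complex.normSq (T i j) * p i : ℝ) : ℂ) := fun j => by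
    have : Wᴴ * (U * (Matrix.diagonal fun i => (p i : ℂ)) * Uᴴ) * W =
        Tᴴ * ((Matrix.diagonal fun i => (p i : ℂ)) * T) := by
      simp only [hT, Matrix.conjTranspose_mul, Matrix.conjTranspose_conjTranspose,
        Matrix.mul_assoc]
    rw [this, Matrix.mul_apply]
    push_cast
    refine Finset.sum_congr rfl fun i _ => ?_
    rw [Matrix.diagonal_mul, Matrix.conjTranspose_apply, Complex.normSq_eq_conj_mul_self]
    simp only [Complex.star_def]
    ring
  have e₁ : ((U * (Matrix.diagonal fun i => (p i : ℂ)) * Uᴴ) *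
      matrixLog (U * (Matrix.diagonal fun i => (p i : ℂ)) * Uᴴ)).trace.re =
      ∑ i, ∑ j, Complex.normSq (T i j) * (p i * Real.log (p i)) := by
    rw [matrixLog_spectral hU, trace_mul_conj_diagonal, mul_mul_conjTranspose_sandwich hU]
    simp_rw [← Finset.sum_mul, hrow, one_mul, Matrix.diagonal_apply_eq]
    simp [← Complex.ofReal_mul]
  have e₂ : ((U * (Matrix.diagonal fun i => (p i : ℂ)) * Uᴴ) *
      matrixLog (W * (Matrix.diagonal fun i => (q i : ℂ)) * Wᴴ)).trace.re =
      ∑ i, ∑ j, Complex.normSq (T i j) * (p i * Real.log (q j)) := by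
    rw [matrixLog_spectral hW, trace_mul_conj_diagonal, Finset.sum_comm, Complex.re_sum]
    refine Finset.sum_congr rfl fun j _ => ?_
    rw [hdiag, ← Complex.ofReal_mul, Complex.ofReal_re, Finset.sum_mul]
    exact Finset.sum_congr rfl fun i _ => by ring
  have e₃ : ∑ i, ∑ j, Complex.normSq (T i j) * p i = ∑ i, ∑ j, Complex.normSq (T i j) * q j := by
    rw [Finset.sum_comm (f := fun i j => Complex.normSq (T i j) * q j)]
    simp_rw [← Finset.sum_mul, hrow, hcol, one_mul]
    rw [Matrix.trace_mul_comm, ← Matrix.mul_assoc, hU, Matrix.one_mul, Matrix.trace_mul_comm,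
      ← Matrix.mul_assoc, hW, Matrix.one_mul, Matrix.trace_diagonal, Matrix.trace_diagonal] at ht
    exact_mod_cast ht
  have hsupp : ∀ i j, q j = 0 → (p i : ℂ) * T i j = 0 := fun i j hj => by
    have h₁ : Uᴴ * ((U * (Matrix.diagonal fun i => (p i : ℂ)) * Uᴴ) * W) =
        (Matrix.diagonal fun i => (p i : ℂ)) * T := by
      simp only [hT, ← Matrix.mul_assoc]
      rw [hU, Matrix.one_mul]
    have h₂ := congrFun (congrFun h₁ i) j
    rw [Matrix.diagonal_mul] at h₂
    rw [← h₂, Matrix.mul_apply]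
    exact Finset.sum_eq_zero fun k _ => by rw [diag_eq_zero_of_ker_le hW h hj k, mul_zero]
  -- The added `- p i + q j` sums to zero because the traces agree, and it makes every term
  -- nonnegative.
  set t : n → n → ℝ := fun i j => Complex.normSq (T i j) *
    (p i * Real.log (p i) - p i * Real.log (q j) - p i + q j) with htd
  have hsum : ((U * (Matrix.diagonal fun i => (p i : ℂ)) * Uᴴ) *
      matrixLog (U * (Matrix.diagonal fun i => (p i : ℂ)) * Uᴴ)).trace.re -
      ((U * (Matrix.diagonal fun i => (p i : ℂ)) * Uᴴ) *
      matrixLog (W * (Matrix.diagonal fun i => (q i : ℂ)) * Wᴴ)).trace.re = ∑ i, ∑ j, t i j := by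
    simp only [htd, mul_add, mul_sub, Finset.sum_add_distrib, Finset.sum_sub_distrib]
    rw [e₁, e₂]
    linarith
  have hterm : ∀ i j, 0 ≤ t i j ∧ (t i j = 0 → (p i : ℂ) * T i j = T i j * (q j : ℂ)) :=
    fun i j => by
    rcases (hq j).eq_or_lt with hj | hj
    -- Here `klein_scalar` does not apply, but the support condition forces `p i = 0` or `T i j =
    -- 0`, so the term vanishes.
    · have h₀ := hsupp i j hj.symm
      refine ⟨?_, fun _ => by rw [h₀, ← hj]; simp⟩
      rcases mul_eq_zero.1 h₀ with h₀ | h₀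
      · simp [htd, ← hj, Complex.ofReal_eq_zero.1 h₀]
      · simp [htd, h₀]
    · obtain ⟨k₁, k₂⟩ := klein_scalar (hp i) hj
      refine ⟨mul_nonneg (Complex.normSq_nonneg _) k₁, fun h₀ => ?_⟩
      rcases mul_eq_zero.1 h₀ with h₀ | h₀
      · simp [Complex.normSq_eq_zero.1 h₀]
      · rw [k₂ h₀, mul_comm]
  rw [hsum]
  refine ⟨Finset.sum_nonneg fun i _ => Finset.sum_nonneg fun j _ => (hterm i j).1, fun h₀ => ?_⟩
  have hz : ∀ i j, t i j = 0 := fun i j =>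
    (Finset.sum_eq_zero_iff_of_nonneg fun j _ => (hterm i j).1).1
      ((Finset.sum_eq_zero_iff_of_nonneg fun i _ =>
        Finset.sum_nonneg fun j _ => (hterm i j).1).1 h₀ i (Finset.mem_univ _)) j
      (Finset.mem_univ _)
  -- Equality forces `p i = q j` wherever `T i j ≠ 0`, so `T` intertwines the two diagonal matrices.
  have hcomm : (Matrix.diagonal fun i => (p i : ℂ)) * T = T * Matrix.diagonal fun i => (q i : ℂ) := by
    ext i j
    rw [Matrix.diagonal_mul, Matrix.mul_diagonal, (hterm i j).2 (hz i j)]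
  calc U * (Matrix.diagonal fun i => (p i : ℂ)) * Uᴴ
      = U * ((Matrix.diagonal fun i => (p i : ℂ)) * T) * Wᴴ := by
        simp only [hT, Matrix.mul_assoc, hW', Matrix.mul_one]
    _ = W * (Matrix.diagonal fun i => (q i : ℂ)) * Wᴴ := by
        rw [hcomm, hT, ← Matrix.mul_assoc, ← Matrix.mul_assoc, hU', Matrix.one_mul]

theorem relativeEntropy_self (ρ : Matrix n n ℂ) : relativeEntropy ρ ρ = 0 := by
  rw [relativeEntropy, if_pos fun _ h => h]
  simp

theorem eq_of_relativeEntropy_eq_zero {ρ σ : Matrix n n ℂ} (hρ : ρ.PosSemidef)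
    (hσ : σ.PosSemidef) (ht : ρ.trace = σ.trace) (h : relativeEntropy ρ σ = 0) : ρ = σ := by
  rw [relativeEntropy] at h
  split_ifs at h with hk
  · exact (klein hρ hσ ht hk).2 (by exact_mod_cast h)
  · simp at h

/-- Two nonnegative quadratic forms with sum zero both vanish. This supplies the support condition
for comparing a state with a mixture containing it. -/
theorem mulVec_eq_zero_of_add {ρ σ : Matrix n n ℂ} (hρ : ρ.PosSemidef) (hσ : σ.PosSemidef)
    {v : n → ℂ} (h : (ρ + σ) *ᵥ v = 0) : ρ *ᵥ v = 0 := by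
  have h₁ := hρ.dotProduct_mulVec_nonneg v
  have h₂ := hσ.dotProduct_mulVec_nonneg v
  have h₃ : star v ⬝ᵥ (ρ *ᵥ v) + star v ⬝ᵥ (σ *ᵥ v) = 0 := by
    rw [← dotProduct_add, ← Matrix.add_mulVec, h, dotProduct_zero]
  exact (hρ.dotProduct_mulVec_zero_iff v).1 ((add_eq_zero_iff_of_nonneg h₁ h₂).1 h₃).1

/-- Strict concavity of the von Neumann entropy at midpoints. -/
theorem eq_of_vonNeumannEntropy_midpoint {ρ σ : Matrix n n ℂ} (hρ : ρ.PosSemidef)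
    (hσ : σ.PosSemidef) (ht : ρ.trace = σ.trace)
    (h : 2 * vonNeumannEntropy ((2⁻¹ : ℂ) • (ρ + σ)) = vonNeumannEntropy ρ + vonNeumannEntropy σ) :
    ρ = σ := by
  set τ := (2⁻¹ : ℂ) • (ρ + σ) with hτ
  have hτ₂ : ρ + σ = (2 : ℂ) • τ := by rw [hτ, smul_smul]; norm_num
  have hτp : τ.PosSemidef := (hρ.add hσ).smul (by norm_num [Complex.le_def])
  have k₁ : ∀ v, τ *ᵥ v = 0 → ρ *ᵥ v = 0 := fun v hv =>
    mulVec_eq_zero_of_add hρ hσ (by rw [hτ₂, Matrix.smul_mulVec, hv, smul_zero])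
  have k₂ : ∀ v, τ *ᵥ v = 0 → σ *ᵥ v = 0 := fun v hv =>
    mulVec_eq_zero_of_add hσ hρ (by rw [add_comm, hτ₂, Matrix.smul_mulVec, hv, smul_zero])
  have t₁ : ρ.trace = τ.trace := by
    rw [hτ, Matrix.trace_smul, Matrix.trace_add, ← ht, smul_eq_mul]; ring
  obtain ⟨a₁, a₂⟩ := klein hρ hτp t₁ k₁
  obtain ⟨b₁, b₂⟩ := klein hσ hτp (ht ▸ t₁) k₂
  -- The cross terms combine, so `2 S(τ) - S(ρ) - S(σ)` is the sum of the relative entropies of `ρ`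
  -- and `σ` to `τ`; both are nonnegative, hence both vanish.
  have hs : (ρ * matrixLog τ).trace.re + (σ * matrixLog τ).trace.re =
      2 * (τ * matrixLog τ).trace.re := by
    rw [← Complex.add_re, ← Matrix.trace_add, ← Matrix.add_mul, hτ₂, Matrix.smul_mul,
      Matrix.trace_smul]
    simp
  simp only [vonNeumannEntropy] at h
  rw [a₂ (by linarith), ← b₂ (by linarith)]

end Spectral

/-! ### Exchanging the two sides, so that each half is proved once. -/

section Swap

variable {A B a b A' B' : Type*}

/-- Exchange of the two tensor factors, on rows and columns. -/
def swapFactors (V : Matrix (A × B) (a × b) ℂ) : Matrix (B × A) (b × a) ℂ :=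
  V.submatrix (Equiv.prodComm B A) (Equiv.prodComm b a)

theorem swapFactors_apply (V : Matrix (A × B) (a × b) ℂ) (β : B) (α : A) (j : b) (i : a) :
    swapFactors V (β, α) (j, i) = V (α, β) (i, j) := rfl

theorem swapFactors_swapFactors (V : Matrix (A × B) (a × b) ℂ) :
    swapFactors (swapFactors V) = V := rfl

theorem swapFactors_injective :
    Function.Injective (swapFactors : Matrix (A × B) (a × b) ℂ → Matrix (B × A) (b × a) ℂ) :=
  Function.LeftInverse.injective swapFactors_swapFactors

theorem swapFactors_mul [Fintype a] [Fintype b] (V : Matrix (A × B) (a × b) ℂ)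
    (W : Matrix (a × b) (A' × B') ℂ) :
    swapFactors (V * W) = swapFactors V * swapFactors W :=
  (Matrix.submatrix_mul_equiv V W _ (Equiv.prodComm b a) _).symm

theorem swapFactors_conjTranspose (V : Matrix (A × B) (a × b) ℂ) :
    swapFactors Vᴴ = (swapFactors V)ᴴ := rfl

theorem swapFactors_kronecker (P : Matrix A a ℂ) (Q : Matrix B b ℂ) :
    swapFactors (P ⊗ₖ Q) = Q ⊗ₖ P := by
  ext ⟨β, α⟩ ⟨j, i⟩
  exact mul_comm _ _

theorem swapFactors_one [DecidableEq A] [DecidableEq B] :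
    swapFactors (1 : Matrix (A × B) (A × B) ℂ) = 1 :=
  Matrix.submatrix_one_equiv (Equiv.prodComm B A)

theorem traceRight_swapFactors [Fintype A] (M : Matrix (A × B) (A × B) ℂ) :
    traceRight (swapFactors M) = traceLeft M := rfl

theorem traceLeft_swapFactors [Fintype B] (M : Matrix (A × B) (A × B) ℂ) :
    traceLeft (swapFactors M) = traceRight M := rfl

theorem trace_swapFactors [Fintype A] [Fintype B] (M : Matrix (A × B) (A × B) ℂ) :
    (swapFactors M).trace = M.trace :=
  (Equiv.prodComm B A).sum_comp fun x => M x x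

end Swap

/-! ### Isometries, unitary extensions and quadratic forms. -/

section Isometries

variable {m n : Type*} [Fintype m] [Fintype n] [DecidableEq m] [DecidableEq n]

theorem card_le_of_isometry {E : Matrix m n ℂ} (hE : Eᴴ * E = 1) :
    Fintype.card n ≤ Fintype.card m := by
  have h : (Eᴴ * E).rank = Fintype.card n := by rw [hE, Matrix.rank_one]
  rw [← h]
  exact (Matrix.rank_mul_le_right _ _).trans (Matrix.rank_le_card_height _)

/-- Linear combinations of the columns which form an orthonormal basis of the column space. -/
theorem exists_orthonormal_columns (P : Matrix m n ℂ) :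
    ∃ (k : ℕ) (R : Matrix n (Fin k) ℂ), (P * R)ᴴ * (P * R) = 1 ∧ P * R * (P * R)ᴴ * P = P := by
  let S : Submodule ℂ (EuclideanSpace ℂ m) := LinearMap.range (Matrix.toEuclideanLin P)
  let b := stdOrthonormalBasis ℂ S
  -- Each basis vector of the range of `P` is `P` applied to some vector; these preimages are the
  -- columns of `R`.
  choose x hx using fun l => (b l).2
  have hR : ∀ α l, (P * Matrix.of fun c l => x l c) α l = (b l : EuclideanSpace ℂ m) α := by
    intro α l
    rw [← hx l]
    simp [Matrix.mul_apply, Matrix.mulVec, dotProduct]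
  refine ⟨Module.finrank ℂ S, Matrix.of fun c l => x l c, ?_, ?_⟩
  · ext l l'
    have := orthonormal_iff_ite.1 b.orthonormal l l'
    rw [Submodule.coe_inner, EuclideanSpace.inner_eq_star_dotProduct] at this
    rw [Matrix.one_apply, ← this, Matrix.mul_apply]
    simp only [Matrix.conjTranspose_apply, hR, dotProduct]
    exact Finset.sum_congr rfl fun _ _ => mul_comm _ _
  · ext α c
    have hc : WithLp.toLp 2 (P.col c) ∈ S :=
      ⟨EuclideanSpace.single c 1, by ext; simp [Matrix.toEuclideanLin]⟩
    have := congrArg (fun v : S => (v : EuclideanSpace ℂ m) α) (b.sum_repr ⟨_, hc⟩)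
    simp only [Submodule.coe_sum, Submodule.coe_smul, WithLp.ofLp_sum, Finset.sum_apply,
      WithLp.ofLp_smul, Pi.smul_apply, smul_eq_mul, Matrix.col_apply] at this
    rw [← this, Matrix.mul_assoc, Matrix.mul_apply]
    refine Finset.sum_congr rfl fun l _ => ?_
    rw [hR, mul_comm, b.repr_apply_apply, Submodule.coe_inner,
      EuclideanSpace.inner_eq_star_dotProduct, Matrix.mul_apply]
    simp only [Matrix.conjTranspose_apply, hR, dotProduct]
    congr 1
    exact Finset.sum_congr rfl fun _ _ => mul_comm _ _

/-- Orthonormal columns extend to a unitary matrix. -/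
theorem exists_unitary_extension {ι : Type*} [Fintype ι] [DecidableEq ι]
    (hι : Fintype.card m = Fintype.card ι) {E : Matrix m n ℂ} (hE : Eᴴ * E = 1) {f : n → ι}
    (hf : Function.Injective f) :
    ∃ W : Matrix m ι ℂ, Wᴴ * W = 1 ∧ W * Wᴴ = 1 ∧ ∀ x c, W x (f c) = E x c := by
  let v : ι → EuclideanSpace ℂ m := Function.extend f (fun c => WithLp.toLp 2 (E.col c)) 0
  have hv : ∀ c, v (f c) = WithLp.toLp 2 (E.col c) := fun c => hf.extend_apply _ _ c
  have ho : Orthonormal ℂ ((Set.range f).domRestrict v) := by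
    rw [orthonormal_iff_ite]
    rintro ⟨_, c, rfl⟩ ⟨_, c', rfl⟩
    have := congrFun (congrFun hE c) c'
    rw [Matrix.one_apply, Matrix.mul_apply] at this
    refine Eq.trans ?_ (this.trans (if_congr ⟨fun h => Subtype.ext (congrArg f h), fun h =>
      hf (congrArg Subtype.val h)⟩ rfl rfl))
    change inner ℂ (v (f c)) (v (f c')) = _
    rw [hv, hv, EuclideanSpace.inner_eq_star_dotProduct]
    exact Finset.sum_congr rfl fun _ _ => mul_comm _ _
  obtain ⟨b, hb⟩ := ho.exists_orthonormalBasis_extension_of_card_eq (by simpa using hι)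
  have hW : (Matrix.of fun x i => b i x : Matrix m ι ℂ)ᴴ * (Matrix.of fun x i => b i x) = 1 := by
    ext i i'
    rw [Matrix.one_apply, ← orthonormal_iff_ite.1 b.orthonormal i i',
      EuclideanSpace.inner_eq_star_dotProduct]
    simp only [Matrix.mul_apply, dotProduct]
    exact Finset.sum_congr rfl fun _ _ => mul_comm _ _
  refine ⟨_, hW, (Matrix.mul_eq_one_comm_of_card_eq _ _ _ hι.symm).1 hW, fun x c => ?_⟩
  rw [Matrix.of_apply, hb _ ⟨c, rfl⟩, hv]
  rfl

/-- Complex polarization; no Hermiticity is needed. -/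
theorem eq_zero_of_quadratic_form {M : Matrix n n ℂ}
    (h : ∀ v : n → ℂ, star v ⬝ᵥ (M *ᵥ v) = 0) : M = 0 := by
  have : Matrix.toEuclideanLin M = 0 := by
    rw [← inner_map_self_eq_zero]
    intro x
    rw [← inner_conj_symm, EuclideanSpace.inner_eq_star_dotProduct, dotProduct_comm]
    simpa using h x.ofLp
  simpa using this

theorem eq_zero_of_quadratic_form_unit {M : Matrix n n ℂ}
    (h : ∀ v : n → ℂ, star v ⬝ᵥ v = 1 → star v ⬝ᵥ (M *ᵥ v) = 0) : M = 0 := by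
  refine eq_zero_of_quadratic_form fun v => ?_
  by_cases hv : v = 0
  · simp [hv]
  have hpos : 0 < star v ⬝ᵥ v := Matrix.dotProduct_star_self_pos_iff.2 hv
  obtain ⟨r, hr, hrv⟩ : ∃ r : ℝ, 0 < r ∧ star v ⬝ᵥ v = r := by
    refine ⟨(star v ⬝ᵥ v).re, (Complex.lt_def.1 hpos).1, ?_⟩
    exact Complex.ext rfl (by simpa using (Complex.lt_def.1 hpos).2.symm)
  set c : ℂ := (((Real.sqrt r)⁻¹ : ℝ) : ℂ) with hc
  have hcc : c * c = (r : ℂ)⁻¹ := by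
    rw [hc, ← Complex.ofReal_mul, ← mul_inv, Real.mul_self_sqrt hr.le, Complex.ofReal_inv]
  have hstar : star c = c := Complex.conj_ofReal _
  have hr' : (r : ℂ) ≠ 0 := by exact_mod_cast hr.ne'
  have h₁ := h (c • v) (by
    rw [star_smul, hstar, smul_dotProduct, dotProduct_smul, smul_smul, hcc, hrv, smul_eq_mul,
      inv_mul_cancel₀ hr'])
  rw [star_smul, hstar, smul_dotProduct, Matrix.mulVec_smul, dotProduct_smul, smul_smul, hcc,
    smul_eq_mul] at h₁
  exact (mul_eq_zero.1 h₁).resolve_left (inv_ne_zero hr')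

end Isometries

/-! ### Existence and dimension count of the decompositions. -/

section Decomposition

variable {S s : Type*} [Fintype S] [Fintype s] [DecidableEq S] [DecidableEq s]

theorem IsDecomposition.card_eq {m r : ℕ} {D : Matrix S ((s × Fin m) ⊕ Fin r) ℂ}
    (hD : IsDecomposition D) : Fintype.card S = Fintype.card s * m + r := by
  have h₁ := card_le_of_isometry hD.1
  have h₂ := card_le_of_isometry (E := Dᴴ) (by simpa using hD.2.1)
  simpa using le_antisymm h₂ h₁

theorem exists_isDecomposition [Nonempty s] :
    ∃ (m r : ℕ) (D : Matrix S ((s × Fin m) ⊕ Fin r) ℂ), IsDecomposition D := by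
  have hs : 0 < Fintype.card s := Fintype.card_pos
  -- Euclidean division of `|S|` by `|s|`: `m` is the quotient, `r` the remainder, and the unitary
  -- merely relabels the basis.
  let e : ((s × Fin (Fintype.card S / Fintype.card s)) ⊕ Fin (Fintype.card S % Fintype.card s)) ≃ S :=
    Fintype.equivOfCardEq (by simpa using Nat.div_add_mod _ _)
  refine ⟨_, _, (1 : Matrix S S ℂ).submatrix id e, ?_, ?_, Nat.mod_lt _ hs⟩
  · rw [Matrix.conjTranspose_submatrix, ← Matrix.submatrix_mul _ _ _ _ _ Function.bijective_id]
    simp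
  · rw [Matrix.conjTranspose_submatrix, Matrix.submatrix_mul_equiv]
    simp

end Decomposition

/-! ### Decoupling, reconstruction and factorization for one side. -/

section Factorization

variable {A B a b κ : Type*} [Fintype A] [Fintype B] [Fintype a] [Fintype b] [Fintype κ]
  [DecidableEq A] [DecidableEq B] [DecidableEq a] [DecidableEq b] [DecidableEq κ]

/-- The code vectors with first logical label `i`, as a matrix from `H_B ⊗ H_b` to `H_A`. -/
def slice (V : Matrix (A × B) (a × b) ℂ) (i : a) : Matrix A (B × b) ℂ :=
  fun α x => V (α, x.1) (i, x.2)

/-- Isometries `E i : ℂ ^ κ → H_A` with mutually orthogonal ranges. -/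
def IsOrthogonalIsometries (E : a → Matrix A κ ℂ) : Prop :=
  ∀ i i', (E i)ᴴ * E i' = if i = i' then 1 else 0

/-- The Gram matrices of the slices do not depend on the first logical label, and different
slices are orthogonal: the environment `B` learns nothing about `a`. -/
def Decoupled (V : Matrix (A × B) (a × b) ℂ) : Prop :=
  ∃ G : Matrix (B × b) (B × b) ℂ, ∀ i i', (slice V i)ᴴ * slice V i' = if i = i' then G else 0

/-- The `A`-half of the basis factorization. -/
def LeftFactorization (V : Matrix (A × B) (a × b) ℂ) {m r : ℕ}
    (D : Matrix A ((a × Fin m) ⊕ Fin r) ℂ) : Prop :=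
  ∃ U ∈ Matrix.unitaryGroup A ℂ, ∃ χ : b → EuclideanSpace ℂ (Fin m × B),
    Orthonormal ℂ χ ∧
    ∀ i j, V.col (i, j) = (U ⊗ₖ (1 : Matrix B B ℂ)) *ᵥ placeLeft D i (χ j)

/-- The `A`-half of the operator reconstruction. -/
def LeftReconstruction (V : Matrix (A × B) (a × b) ℂ) : Prop :=
  ∀ O : Matrix a a ℂ, ∃ OA : Matrix A A ℂ,
    (OA ⊗ₖ (1 : Matrix B B ℂ)) * V = V * (O ⊗ₖ (1 : Matrix b b ℂ)) ∧
    (OAᴴ ⊗ₖ (1 : Matrix B B ℂ)) * V = V * (Oᴴ ⊗ₖ (1 : Matrix b b ℂ))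

/-- Operators on `H_a` commute with the compressions to the code of operators on `H_B`. -/
def LeftCommutes (V : Matrix (A × B) (a × b) ℂ) : Prop :=
  ∀ (O : Matrix a a ℂ) (X : Matrix B B ℂ),
    (O ⊗ₖ (1 : Matrix b b ℂ)) * (Vᴴ * ((1 : Matrix A A ℂ) ⊗ₖ X) * V) =
      (Vᴴ * ((1 : Matrix A A ℂ) ⊗ₖ X) * V) * (O ⊗ₖ (1 : Matrix b b ℂ))

theorem kronecker_one_mul_apply (P : Matrix A A ℂ) (M : Matrix (A × B) (a × b) ℂ) (α : A) (β : B)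
    (y : a × b) : ((P ⊗ₖ (1 : Matrix B B ℂ)) * M) (α, β) y = ∑ α', P α α' * M (α', β) y := by
  simp [Matrix.mul_apply, Fintype.sum_prod_type, Matrix.kroneckerMap_apply, Matrix.one_apply]

theorem kronecker_one_mulVec_apply (P : Matrix A A ℂ) (v : A × B → ℂ) (α : A) (β : B) :
    ((P ⊗ₖ (1 : Matrix B B ℂ)) *ᵥ v) (α, β) = ∑ α', P α α' * v (α', β) := by
  simp [Matrix.mulVec, dotProduct, Fintype.sum_prod_type, Matrix.kroneckerMap_apply,
    Matrix.one_apply]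

theorem mul_kronecker_one_apply (M : Matrix (A × B) (a × b) ℂ) (P : Matrix a a ℂ) (x : A × B)
    (i : a) (j : b) : (M * (P ⊗ₖ (1 : Matrix b b ℂ))) x (i, j) = ∑ i', M x (i', j) * P i' i := by
  simp [Matrix.mul_apply, Fintype.sum_prod_type, Matrix.kroneckerMap_apply, Matrix.one_apply]

theorem slice_kronecker_one_mul (P : Matrix A A ℂ) (V : Matrix (A × B) (a × b) ℂ) (i : a) :
    slice ((P ⊗ₖ (1 : Matrix B B ℂ)) * V) i = P * slice V i := by
  ext α x
  rw [slice, kronecker_one_mul_apply, Matrix.mul_apply]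
  rfl

theorem slice_mul_kronecker_one (V : Matrix (A × B) (a × b) ℂ) (P : Matrix a a ℂ) (i : a) :
    slice (V * (P ⊗ₖ (1 : Matrix b b ℂ))) i = ∑ i', P i' i • slice V i' := by
  ext α x
  rw [slice, mul_kronecker_one_apply, Matrix.sum_apply]
  exact Finset.sum_congr rfl fun _ _ => mul_comm _ _

theorem slice_ext {V W : Matrix (A × B) (a × b) ℂ} (h : ∀ i, slice V i = slice W i) : V = W := by
  ext ⟨α, β⟩ ⟨i, j⟩
  exact congrFun (congrFun (h i) α) (β, j)

theorem sum_slice_gram (V : Matrix (A × B) (a × b) ℂ) (i i' : a) (j j' : b) :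
    (Vᴴ * V) (i, j) (i', j') = ∑ β, ((slice V i)ᴴ * slice V i') (β, j) (β, j') := by
  simp only [Matrix.mul_apply, Fintype.sum_prod_type]
  exact Finset.sum_comm

/-- Matrix units on `B` isolate single entries of the slice Gram matrices; this links commutators
and reduced states to decoupling. -/
theorem compression_single_apply (V : Matrix (A × B) (a × b) ℂ) (β β' : B) (i i' : a) (j j' : b) :
    (Vᴴ * ((1 : Matrix A A ℂ) ⊗ₖ (Matrix.single β β' 1 : Matrix B B ℂ)) * V) (i, j) (i', j') =
      ((slice V i)ᴴ * slice V i') (β, j) (β', j') := by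
  have : ∀ α β₂, (Vᴴ * ((1 : Matrix A A ℂ) ⊗ₖ (Matrix.single β β' 1 : Matrix B B ℂ))) (i, j) (α, β₂) =
      if β' = β₂ then star (V (α, β) (i, j)) else 0 := fun α β₂ => by
    rw [Matrix.mul_apply, Fintype.sum_prod_type, Finset.sum_eq_single α, Finset.sum_eq_single β]
    · simp [Matrix.single_apply]
    · intro γ _ hγ
      simp [Matrix.single_apply, hγ.symm]
    · simp
    · intro γ _ hγ
      simp [Matrix.one_apply, hγ]
    · simp
  rw [Matrix.mul_apply, Fintype.sum_prod_type, Matrix.mul_apply]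
  refine Finset.sum_congr rfl fun α _ => ?_
  simp [this, slice]

/-- `OA` commutes with operators on `B`. The ket equation moves it through `V`, and the adjoint of
the bra equation moves it through `Vᴴ`. -/
theorem LeftReconstruction.leftCommutes {V : Matrix (A × B) (a × b) ℂ}
    (h : LeftReconstruction V) : LeftCommutes V := by
  intro O X
  obtain ⟨OA, h₁, h₂⟩ := h O
  have h₃ : Vᴴ * (OA ⊗ₖ (1 : Matrix B B ℂ)) = (O ⊗ₖ (1 : Matrix b b ℂ)) * Vᴴ := by
    have := congrArg Matrix.conjTranspose h₂
    simpa [Matrix.conjTranspose_mul, Matrix.conjTranspose_kronecker] using this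
  have h₄ : ((1 : Matrix A A ℂ) ⊗ₖ X) * (OA ⊗ₖ (1 : Matrix B B ℂ)) =
      (OA ⊗ₖ (1 : Matrix B B ℂ)) * ((1 : Matrix A A ℂ) ⊗ₖ X) := by
    simp [← Matrix.mul_kronecker_mul]
  calc _ = (O ⊗ₖ (1 : Matrix b b ℂ)) * Vᴴ * (((1 : Matrix A A ℂ) ⊗ₖ X) * V) := by
        simp only [Matrix.mul_assoc]
    _ = Vᴴ * (((1 : Matrix A A ℂ) ⊗ₖ X) * (OA ⊗ₖ (1 : Matrix B B ℂ)) * V) := by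
        rw [← h₃, h₄]
        simp only [Matrix.mul_assoc]
    _ = _ := by
        rw [Matrix.mul_assoc ((1 : Matrix A A ℂ) ⊗ₖ X), h₁]
        simp only [Matrix.mul_assoc]

theorem LeftCommutes.decoupled [Nonempty a] {V : Matrix (A × B) (a × b) ℂ}
    (h : LeftCommutes V) : Decoupled V := by
  obtain ⟨p⟩ := ‹Nonempty a›
  refine ⟨(slice V p)ᴴ * slice V p, fun i i' => ?_⟩
  ext ⟨β, j⟩ ⟨β', j'⟩
  -- With `O = |p⟩⟨i|`, one side of this entry is the `(i, i')` Gram entry and the other is the `(p,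
  -- p)` entry, present only when `i = i'`.
  have := congrFun (congrFun (h (Matrix.single p i 1) (Matrix.single β β' 1)) (p, j)) (i', j')
  rw [kronecker_one_mul_apply, mul_kronecker_one_apply] at this
  simp only [compression_single_apply, Matrix.single_apply] at this
  split_ifs with hi
  · subst hi
    simpa using this
  · simpa [hi] using this

/-- The representative is `∑ O i' i • E i' (E i)ᴴ`, which acts on the labels of the ranges. Its
adjoint is the same expression for `Oᴴ`, so one computation covers kets and bras. -/
theorem IsOrthogonalIsometries.leftReconstruction {V : Matrix (A × B) (a × b) ℂ}
    {E : a → Matrix A κ ℂ} (hE : IsOrthogonalIsometries E) {C : Matrix κ (B × b) ℂ}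
    (hV : ∀ i, slice V i = E i * C) : LeftReconstruction V := by
  have key : ∀ O : Matrix a a ℂ,
      ((∑ i, ∑ i', O i' i • (E i' * (E i)ᴴ)) ⊗ₖ (1 : Matrix B B ℂ)) * V =
        V * (O ⊗ₖ (1 : Matrix b b ℂ)) := fun O => by
    refine slice_ext fun p => ?_
    rw [slice_kronecker_one_mul, slice_mul_kronecker_one, hV, ← Matrix.mul_assoc,
      Matrix.sum_mul, Finset.sum_eq_single p]
    · simp only [Matrix.sum_mul, Matrix.smul_mul, Matrix.mul_assoc, hV]
      refine Finset.sum_congr rfl fun i' _ => ?_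
      rw [← Matrix.mul_assoc (E p)ᴴ, hE p p, if_pos rfl, Matrix.one_mul]
    · intro q _ hq
      rw [Matrix.sum_mul]
      refine Finset.sum_eq_zero fun i' _ => ?_
      rw [Matrix.smul_mul, Matrix.mul_assoc, hE q p, if_neg hq, Matrix.mul_zero, smul_zero]
    · simp
  refine fun O => ⟨_, key O, ?_⟩
  convert key Oᴴ using 3
  simp only [Matrix.conjTranspose_sum, Matrix.conjTranspose_smul, Matrix.conjTranspose_mul,
    Matrix.conjTranspose_conjTranspose, Matrix.conjTranspose_apply]
  exact Finset.sum_comm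

/-- All slices share the Gram matrix `G`, hence the same linear relations among columns. A matrix
`R` orthonormalizing the columns of one slice therefore works for all: `E i = V_i R` and `C = Rᴴ G`.
-/
theorem Decoupled.exists_isOrthogonalIsometries [Nonempty a] {V : Matrix (A × B) (a × b) ℂ}
    (h : Decoupled V) : ∃ (k : ℕ) (E : a → Matrix A (Fin k) ℂ) (C : Matrix (Fin k) (B × b) ℂ),
      IsOrthogonalIsometries E ∧ ∀ i, slice V i = E i * C := by
  obtain ⟨p⟩ := ‹Nonempty a›
  obtain ⟨G, hG⟩ := h
  have hG' : ∀ i, (slice V i)ᴴ * slice V i = G := fun i => by rw [hG, if_pos rfl]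
  obtain ⟨k, R, h₁, h₂⟩ := exists_orthonormal_columns (slice V p)
  have hR : Rᴴ * G * R = 1 := by
    rw [← hG' p, ← h₁, Matrix.conjTranspose_mul]
    simp only [Matrix.mul_assoc]
  have hGh : Gᴴ = G := by rw [← hG' p]; simp
  have hGQ : G * (R * (Rᴴ * G)) = G := by
    have := congrArg ((slice V p)ᴴ * ·) h₂
    simp only [Matrix.conjTranspose_mul, ← Matrix.mul_assoc, hG'] at this
    rw [Matrix.mul_assoc (G * R * Rᴴ), hG'] at this
    rw [← Matrix.mul_assoc, ← Matrix.mul_assoc, this]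
  refine ⟨k, fun i => slice V i * R, Rᴴ * G, fun i i' => ?_, fun i => ?_⟩
  · rw [Matrix.conjTranspose_mul, Matrix.mul_assoc, ← Matrix.mul_assoc (slice V i)ᴴ, hG]
    split_ifs
    · rw [← Matrix.mul_assoc, hR]
    · simp
  -- With `Q = R Rᴴ G`, the Gram matrix of `V_i - V_i Q` is `G - G - G + G = 0`.
  · rw [← sub_eq_zero, ← Matrix.conjTranspose_mul_self_eq_zero, Matrix.mul_assoc]
    generalize R * (Rᴴ * G) = Q at hGQ
    have e₁ : (slice V i)ᴴ * (slice V i * Q) = G := by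
      rw [← Matrix.mul_assoc, hG', hGQ]
    have e₂ : (slice V i * Q)ᴴ * slice V i = G := by
      have := congrArg Matrix.conjTranspose e₁
      rwa [Matrix.conjTranspose_mul, Matrix.conjTranspose_conjTranspose, hGh] at this
    have e₃ : (slice V i * Q)ᴴ * (slice V i * Q) = G := by
      rw [← Matrix.mul_assoc (slice V i * Q)ᴴ (slice V i) Q, e₂, hGQ]
    rw [Matrix.conjTranspose_sub, Matrix.sub_mul, Matrix.mul_sub, Matrix.mul_sub, hG', e₁, e₂, e₃]
    simp

theorem IsOrthogonalIsometries.uncurry {E : a → Matrix A κ ℂ} (hE : IsOrthogonalIsometries E) :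
    (Matrix.of fun (α : A) (x : a × κ) => E x.1 α x.2)ᴴ *
      (Matrix.of fun (α : A) (x : a × κ) => E x.1 α x.2) = 1 := by
  ext ⟨i, k⟩ ⟨i', k'⟩
  have := congrFun (congrFun (hE i i') k) k'
  rw [Matrix.mul_apply] at this ⊢
  refine this.trans ?_
  by_cases h : i = i'
  · simp [h, Matrix.one_apply]
  · simp [h]

/-- Within one slice the isometry `E p` drops out of inner products, so orthonormality of the code
vectors passes to the columns built from `C`. -/
theorem orthonormal_of_factorization [Nonempty a] {V : Matrix (A × B) (a × b) ℂ} (hV : IsCode V)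
    {E : a → Matrix A κ ℂ} (hE : IsOrthogonalIsometries E) {C : Matrix κ (B × b) ℂ}
    (h : ∀ i, slice V i = E i * C) :
    Orthonormal ℂ fun j => (WithLp.toLp 2 fun x => C x.1 (x.2, j) : EuclideanSpace ℂ (κ × B)) := by
  obtain ⟨p⟩ := ‹Nonempty a›
  rw [orthonormal_iff_ite]
  intro j j'
  have h₁ := sum_slice_gram V p p j j'
  rw [hV, h, Matrix.conjTranspose_mul, Matrix.mul_assoc, ← Matrix.mul_assoc (E p)ᴴ, hE p p,
    if_pos rfl, Matrix.one_mul, Matrix.one_apply] at h₁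
  simp only [Prod.mk.injEq, true_and] at h₁
  rw [h₁, EuclideanSpace.inner_eq_star_dotProduct, dotProduct, Fintype.sum_prod_type,
    Finset.sum_comm]
  exact Finset.sum_congr rfl fun β _ => Finset.sum_congr rfl fun k _ => mul_comm _ _

theorem unitary_mulVec_placeLeft {m r : ℕ} (D : Matrix A ((a × Fin m) ⊕ Fin r) ℂ)
    (U : Matrix A A ℂ) (i : a) (χ : EuclideanSpace ℂ (Fin m × B)) (α : A) (β : B) :
    ((U ⊗ₖ (1 : Matrix B B ℂ)) *ᵥ placeLeft D i χ) (α, β) =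
      ∑ k, (U * D) α (Sum.inl (i, k)) * χ (k, β) := by
  simp only [kronecker_one_mulVec_apply, placeLeft, Matrix.mul_apply, Finset.mul_sum,
    Finset.sum_mul, mul_assoc]
  exact Finset.sum_comm

theorem LeftFactorization.exists_isOrthogonalIsometries {V : Matrix (A × B) (a × b) ℂ} {m r : ℕ}
    {D : Matrix A ((a × Fin m) ⊕ Fin r) ℂ} (hD : IsDecomposition D)
    (h : LeftFactorization V D) :
    ∃ (E : a → Matrix A (Fin m) ℂ) (C : Matrix (Fin m) (B × b) ℂ),
      IsOrthogonalIsometries E ∧ ∀ i, slice V i = E i * C := by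
  obtain ⟨U, hU, χ, -, hχ⟩ := h
  have hUD : (U * D)ᴴ * (U * D) = 1 := by
    rw [Matrix.conjTranspose_mul, Matrix.mul_assoc, ← Matrix.mul_assoc Uᴴ,
      ← Matrix.star_eq_conjTranspose U, Matrix.mem_unitaryGroup_iff'.1 hU, Matrix.one_mul, hD.1]
  refine ⟨fun i => Matrix.of fun α k => (U * D) α (Sum.inl (i, k)),
    Matrix.of fun k x => χ x.2 (k, x.1), fun i i' => ?_, fun i => ?_⟩
  · ext k k'
    have := congrFun (congrFun hUD (Sum.inl (i, k))) (Sum.inl (i', k'))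
    rw [Matrix.mul_apply] at this ⊢
    refine this.trans ?_
    by_cases hi : i = i'
    · simp [hi, Matrix.one_apply]
    · simp [hi]
  · ext α ⟨β, j⟩
    have := congrFun (hχ i j) (α, β)
    rw [unitary_mulVec_placeLeft] at this
    exact this

theorem Decoupled.leftFactorization [Nonempty a] {V : Matrix (A × B) (a × b) ℂ} (hV : IsCode V)
    (h : Decoupled V) {m r : ℕ} {D : Matrix A ((a × Fin m) ⊕ Fin r) ℂ} (hD : IsDecomposition D) :
    LeftFactorization V D := by
  obtain ⟨k, E, C, hE, hC⟩ := h.exists_isOrthogonalIsometries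
  -- `|a| k ≤ |A| = |a| m + r < |a| (m + 1)`; this is where `r < |a|` matters.
  have hk : k ≤ m := by
    have h₁ := card_le_of_isometry hE.uncurry
    rw [hD.card_eq, Fintype.card_prod, Fintype.card_fin] at h₁
    have h₂ : Fintype.card a * k < Fintype.card a * (m + 1) := by
      rw [Nat.mul_succ]
      exact h₁.trans_lt (Nat.add_lt_add_left hD.2.2 _)
    exact Nat.lt_succ_iff.1 (Nat.lt_of_mul_lt_mul_left h₂)
  let f : a × Fin k → (a × Fin m) ⊕ Fin r := fun x => Sum.inl (x.1, Fin.castLE hk x.2)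
  have hf : Function.Injective f := by
    rintro ⟨i, l⟩ ⟨i', l'⟩ h
    simpa [f] using h
  obtain ⟨W, hW, hW', hWE⟩ := exists_unitary_extension
    (by simpa using hD.card_eq) hE.uncurry hf
  have hUD : W * Dᴴ * D = W := by rw [Matrix.mul_assoc, hD.1, Matrix.mul_one]
  -- Padding with zero rows makes the extra columns of `W` irrelevant.
  let C' : Matrix (Fin m) (B × b) ℂ := Function.extend (Fin.castLE hk) C 0
  have hE' : IsOrthogonalIsometries fun i =>
      (Matrix.of fun α l => W α (Sum.inl (i, l)) : Matrix A (Fin m) ℂ) := fun i i' => by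
    ext l l'
    have := congrFun (congrFun hW (Sum.inl (i, l))) (Sum.inl (i', l'))
    rw [Matrix.mul_apply] at this ⊢
    refine this.trans ?_
    by_cases hi : i = i'
    · simp [hi, Matrix.one_apply]
    · simp [hi]
  have hC' : ∀ i, slice V i = (Matrix.of fun α l => W α (Sum.inl (i, l))) * C' := fun i => by
    rw [hC]
    ext α x
    rw [Matrix.mul_apply, Matrix.mul_apply]
    refine Fintype.sum_of_injective (Fin.castLE hk) (Fin.castLE_injective hk) _ _
      (fun l hl => ?_) fun l => ?_
    · have : C' l = 0 := Function.extend_apply' _ _ _ hl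
      exact (congrArg (_ * ·) (congrFun this x)).trans (mul_zero _)
    · have : C' (Fin.castLE hk l) = C l := (Fin.castLE_injective hk).extend_apply _ _ _
      exact congrArg₂ (· * ·) (hWE α (i, l)).symm (congrFun this x).symm
  -- Chosen so that `U * D = W`.
  refine ⟨W * Dᴴ, ?_, _, orthonormal_of_factorization hV hE' hC', fun i j => ?_⟩
  · rw [Matrix.mem_unitaryGroup_iff', Matrix.star_eq_conjTranspose, Matrix.conjTranspose_mul,
      Matrix.conjTranspose_conjTranspose, Matrix.mul_assoc, ← Matrix.mul_assoc Wᴴ, hW,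
      Matrix.one_mul, hD.2.1]
  · ext ⟨α, β⟩
    rw [unitary_mulVec_placeLeft, hUD]
    have := congrFun (congrFun (hC' i) α) (β, j)
    rw [Matrix.mul_apply] at this
    exact this

end Factorization

/-! ### Splitting the two-sided conditions into one-sided ones. -/

section Halves

variable {A B a b : Type*} [Fintype A] [Fintype B] [Fintype a] [Fintype b]
  [DecidableEq A] [DecidableEq B] [DecidableEq a] [DecidableEq b]

/-- By polarization, vanishing expectations on the code mean that the compressed commutator
vanishes; `Vᴴ V = 1` then removes the embedding of `M`. -/
theorem forall_codeSpace_commutator_iff {V : Matrix (A × B) (a × b) ℂ} (hV : IsCode V)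
    (M : Matrix (a × b) (a × b) ℂ) (Y : Matrix (A × B) (A × B) ℂ) :
    (∀ φ ∈ codeSpace V, star φ ⬝ᵥ (⁅logical V M, Y⁆ *ᵥ φ) = 0) ↔
      M * (Vᴴ * Y * V) = (Vᴴ * Y * V) * M := by
  have hVK : ∀ (K : Matrix (A × B) (A × B) ℂ) (ψ : a × b → ℂ),
      star (V *ᵥ ψ) ⬝ᵥ (K *ᵥ (V *ᵥ ψ)) = star ψ ⬝ᵥ ((Vᴴ * K * V) *ᵥ ψ) := fun K ψ => by
    rw [Matrix.star_mulVec, ← Matrix.dotProduct_mulVec, Matrix.mulVec_mulVec, Matrix.mulVec_mulVec,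
      Matrix.mul_assoc]
  have hK : Vᴴ * ⁅logical V M, Y⁆ * V = M * (Vᴴ * Y * V) - (Vᴴ * Y * V) * M := by
    rw [Ring.lie_def, logical, Matrix.mul_sub, Matrix.sub_mul]
    congr 1
    · simp only [← Matrix.mul_assoc]
      rw [hV, Matrix.one_mul]
    · simp only [Matrix.mul_assoc]
      rw [hV, Matrix.mul_one]
  rw [← sub_eq_zero (a := M * _), ← hK]
  constructor
  · intro h
    exact eq_zero_of_quadratic_form fun ψ => by rw [← hVK]; exact h _ ⟨ψ, rfl⟩
  · rintro h _ ⟨ψ, rfl⟩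
    rw [Matrix.mulVecLin_apply, hVK, h, Matrix.zero_mulVec, dotProduct_zero]

theorem vanishingCommutators_iff {V : Matrix (A × B) (a × b) ℂ} (hV : IsCode V) :
    VanishingCommutators V ↔ LeftCommutes V ∧ LeftCommutes (swapFactors V) := by
  have h₁ : LeftCommutes V ↔ ∀ φ ∈ codeSpace V, ∀ (O : Matrix a a ℂ) (X : Matrix B B ℂ),
      star φ ⬝ᵥ (⁅logical V (O ⊗ₖ (1 : Matrix b b ℂ)), (1 : Matrix A A ℂ) ⊗ₖ X⁆ *ᵥ φ) = 0 :=
    ⟨fun h φ hφ O X => (forall_codeSpace_commutator_iff hV _ _).2 (h O X) φ hφ,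
      fun h O X => (forall_codeSpace_commutator_iff hV _ _).1 fun φ hφ => h φ hφ O X⟩
  have h₂ : LeftCommutes (swapFactors V) ↔
      ∀ φ ∈ codeSpace V, ∀ (O : Matrix b b ℂ) (X : Matrix A A ℂ),
      star φ ⬝ᵥ (⁅logical V ((1 : Matrix a a ℂ) ⊗ₖ O), X ⊗ₖ (1 : Matrix B B ℂ)⁆ *ᵥ φ) = 0 := by
    have : ∀ (O : Matrix b b ℂ) (X : Matrix A A ℂ),
        ((O ⊗ₖ (1 : Matrix a a ℂ)) *
            ((swapFactors V)ᴴ * ((1 : Matrix B B ℂ) ⊗ₖ X) * swapFactors V) =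
          ((swapFactors V)ᴴ * ((1 : Matrix B B ℂ) ⊗ₖ X) * swapFactors V) *
            (O ⊗ₖ (1 : Matrix a a ℂ))) ↔
        ((1 : Matrix a a ℂ) ⊗ₖ O) * (Vᴴ * (X ⊗ₖ (1 : Matrix B B ℂ)) * V) =
          (Vᴴ * (X ⊗ₖ (1 : Matrix B B ℂ)) * V) * ((1 : Matrix a a ℂ) ⊗ₖ O) := fun O X => by
      rw [← swapFactors_injective.eq_iff]
      simp only [swapFactors_mul, swapFactors_conjTranspose, swapFactors_kronecker]
      rfl
    exact ⟨fun h φ hφ O X => (forall_codeSpace_commutator_iff hV _ _).2 ((this O X).1 (h O X)) φ hφ,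
      fun h O X => (this O X).2 ((forall_codeSpace_commutator_iff hV _ _).1 fun φ hφ => h φ hφ O X)⟩
  rw [h₁, h₂]
  exact ⟨fun h => ⟨fun φ hφ => (h φ hφ).1, fun φ hφ => (h φ hφ).2⟩,
    fun h φ hφ => ⟨h.1 φ hφ, h.2 φ hφ⟩⟩

theorem forall_codeSpace_mulVec_iff {V : Matrix (A × B) (a × b) ℂ} (hV : IsCode V)
    (M : Matrix (a × b) (a × b) ℂ) (Y : Matrix (A × B) (A × B) ℂ) :
    (∀ ψ ∈ codeSpace V, Y *ᵥ ψ = logical V M *ᵥ ψ) ↔ Y * V = V * M := by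
  have h : logical V M * V = V * M := by rw [logical, Matrix.mul_assoc, hV, Matrix.mul_one]
  constructor
  · intro h'
    refine Matrix.mulVec_injective (funext fun x => ?_)
    rw [← h, ← Matrix.mulVec_mulVec, ← Matrix.mulVec_mulVec]
    exact h' _ ⟨x, rfl⟩
  · rintro h' _ ⟨x, rfl⟩
    rw [Matrix.mulVecLin_apply, Matrix.mulVec_mulVec, Matrix.mulVec_mulVec, h, h']

theorem operatorReconstruction_iff {V : Matrix (A × B) (a × b) ℂ} (hV : IsCode V) :
    OperatorReconstruction V ↔ LeftReconstruction V ∧ LeftReconstruction (swapFactors V) := by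
  have hs : ∀ (O OB), (OB ⊗ₖ (1 : Matrix A A ℂ)) * swapFactors V =
      swapFactors V * (O ⊗ₖ (1 : Matrix a a ℂ)) ↔
      ((1 : Matrix A A ℂ) ⊗ₖ OB) * V = V * ((1 : Matrix a a ℂ) ⊗ₖ O) := fun O OB => by
    rw [← swapFactors_injective.eq_iff]
    simp only [swapFactors_mul, swapFactors_kronecker]
    rfl
  simp only [OperatorReconstruction, LeftReconstruction, forall₂_and,
    forall_codeSpace_mulVec_iff hV]
  exact and_congr Iff.rfl (forall_congr' fun O => exists_congr fun OB =>
    and_congr (hs _ _).symm (hs _ _).symm)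

theorem basisFactorization_iff (V : Matrix (A × B) (a × b) ℂ)
    {mA rA : ℕ} (DA : Matrix A ((a × Fin mA) ⊕ Fin rA) ℂ)
    {mB rB : ℕ} (DB : Matrix B ((b × Fin mB) ⊕ Fin rB) ℂ) :
    BasisFactorization V DA DB ↔
      LeftFactorization V DA ∧ LeftFactorization (swapFactors V) DB := by
  refine and_congr Iff.rfl ?_
  refine exists_congr fun U => and_congr Iff.rfl (exists_congr fun χ => and_congr Iff.rfl ?_)
  have hs : ∀ (v : A × B → ℂ) (α : A) (β : B), (((1 : Matrix A A ℂ) ⊗ₖ U) *ᵥ v) (α, β) =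
      ((U ⊗ₖ (1 : Matrix A A ℂ)) *ᵥ fun x => v (x.2, x.1)) (β, α) := fun v α β => by
    rw [kronecker_one_mulVec_apply, Matrix.mulVec, dotProduct, Fintype.sum_prod_type,
      Finset.sum_comm]
    simp [Matrix.kroneckerMap_apply, Matrix.one_apply]
  constructor
  · intro h j i
    ext ⟨β, α⟩
    exact (congrFun (h i j) (α, β)).trans (hs _ _ _)
  · intro h i j
    ext ⟨α, β⟩
    exact (congrFun (h j i) (β, α)).trans (hs (placeRight DB j (χ i)) α β).symm

theorem IsCode.swapFactors {V : Matrix (A × B) (a × b) ℂ} (hV : IsCode V) :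
    IsCode (swapFactors V) := by
  rw [IsCode, ← swapFactors_conjTranspose, ← swapFactors_mul, hV, swapFactors_one]

end Halves

/-! ### Partial traces and pure product states. -/

section States

variable {m n : Type*} [Fintype m] [Fintype n] [DecidableEq m] [DecidableEq n]

theorem posSemidef_traceLeft {M : Matrix (m × n) (m × n) ℂ} (hM : M.PosSemidef) :
    (traceLeft M).PosSemidef := by
  have : traceLeft M = ∑ i, M.submatrix (fun j => (i, j)) (fun j => (i, j)) := by
    ext j j'
    rw [Matrix.sum_apply]
    rfl
  rw [this]
  exact Matrix.posSemidef_sum _ fun i _ => hM.submatrix _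

theorem trace_traceLeft (M : Matrix (m × n) (m × n) ℂ) : (traceLeft M).trace = M.trace := by
  simp only [Matrix.trace, traceLeft, Fintype.sum_prod_type, Matrix.diag_apply]
  exact Finset.sum_comm

theorem posSemidef_traceRight {M : Matrix (m × n) (m × n) ℂ} (hM : M.PosSemidef) :
    (traceRight M).PosSemidef := by
  rw [← traceLeft_swapFactors]
  exact posSemidef_traceLeft (hM.submatrix _)

theorem trace_traceRight (M : Matrix (m × n) (m × n) ℂ) : (traceRight M).trace = M.trace := by
  rw [← traceLeft_swapFactors, trace_traceLeft, trace_swapFactors]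

theorem traceLeft_add (M N : Matrix (m × n) (m × n) ℂ) :
    traceLeft (M + N) = traceLeft M + traceLeft N := by
  ext j j'
  simp [traceLeft, Finset.sum_add_distrib]

theorem traceLeft_smul (c : ℂ) (M : Matrix (m × n) (m × n) ℂ) :
    traceLeft (c • M) = c • traceLeft M := by
  ext j j'
  simp [traceLeft, Finset.mul_sum]

/-- The rank-one matrix `|φ⟩⟨φ|`. -/
def pureState (φ : n → ℂ) : Matrix n n ℂ :=
  Matrix.vecMulVec φ (star φ)

/-- The product vector `|e⟩|f⟩`. -/
def productVec (e : m → ℂ) (f : n → ℂ) : m × n → ℂ :=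
  fun x => e x.1 * f x.2

theorem posSemidef_pureState (φ : n → ℂ) : (pureState φ).PosSemidef :=
  Matrix.posSemidef_vecMulVec_self_star φ

theorem mul_pureState_mul (V : Matrix m n ℂ) (φ : n → ℂ) :
    V * pureState φ * Vᴴ = pureState (V *ᵥ φ) := by
  rw [pureState, pureState, Matrix.mul_vecMulVec, Matrix.vecMulVec_mul, Matrix.star_mulVec]

theorem traceLeft_pureState_productVec (e : m → ℂ) (f : n → ℂ) :
    traceLeft (pureState (productVec e f)) = (star e ⬝ᵥ e) • pureState f := by
  ext j j'
  simp only [traceLeft, pureState, productVec, Matrix.vecMulVec_apply, Pi.star_apply, star_mul',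
    Matrix.smul_apply, dotProduct, smul_eq_mul, Finset.sum_mul]
  exact Finset.sum_congr rfl fun i _ => by ring

theorem isDensity_pureState_productVec {e : m → ℂ} {f : n → ℂ} (he : star e ⬝ᵥ e = 1)
    (hf : star f ⬝ᵥ f = 1) : IsDensity (pureState (productVec e f)) := by
  refine ⟨posSemidef_pureState _, ?_⟩
  rw [← trace_traceLeft, traceLeft_pureState_productVec, he, one_smul, pureState,
    Matrix.trace_vecMulVec, dotProduct_comm, hf]

end States

/-! ### From indistinguishable environment states to decoupling. -/

section Blind

variable {A B a b : Type*} [Fintype A] [Fintype B] [Fintype a] [Fintype b]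
  [DecidableEq A] [DecidableEq B] [DecidableEq a] [DecidableEq b]

/-- The reduced state on `B` of a product state does not change when the state on `a` is replaced
by an orthogonal one. -/
def EnvironmentBlind (V : Matrix (A × B) (a × b) ℂ) : Prop :=
  ∀ (e e' : a → ℂ) (f : b → ℂ), star e ⬝ᵥ e = 1 → star e' ⬝ᵥ e' = 1 → star e ⬝ᵥ e' = 0 →
    star f ⬝ᵥ f = 1 →
    traceLeft (V * pureState (productVec e f) * Vᴴ) =
      traceLeft (V * pureState (productVec e' f) * Vᴴ)

theorem traceLeft_pureState_apply (V : Matrix (A × B) (a × b) ℂ) (φ : a × b → ℂ) (β β' : B) :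
    traceLeft (V * pureState φ * Vᴴ) β β' =
      star φ ⬝ᵥ ((Vᴴ * ((1 : Matrix A A ℂ) ⊗ₖ (Matrix.single β' β 1 : Matrix B B ℂ)) * V) *ᵥ φ) := by
  rw [mul_pureState_mul, Matrix.mul_assoc, ← Matrix.mulVec_mulVec, Matrix.dotProduct_mulVec,
    ← Matrix.star_mulVec, ← Matrix.mulVec_mulVec]
  generalize V *ᵥ φ = v
  have : ∀ α β₂, (((1 : Matrix A A ℂ) ⊗ₖ (Matrix.single β' β 1 : Matrix B B ℂ)) *ᵥ v) (α, β₂) =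
      if β' = β₂ then v (α, β) else 0 := fun α β₂ => by
    simp only [Matrix.mulVec, dotProduct, Fintype.sum_prod_type, Matrix.kroneckerMap_apply]
    rw [Finset.sum_eq_single α, Finset.sum_eq_single β]
    · simp [Matrix.single_apply]
    · intro γ _ hγ
      simp [Matrix.single_apply, hγ.symm]
    · simp
    · intro γ _ hγ
      simp [Matrix.one_apply, hγ.symm]
    · simp
  simp [traceLeft, pureState, Matrix.vecMulVec_apply, dotProduct, Fintype.sum_prod_type, this,
    mul_comm]

/-- A matrix whose quadratic form takes equal values on orthonormal pairs is scalar. -/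
theorem scalar_of_orthonormal_pairs {K : Matrix a a ℂ}
    (h : ∀ e e' : a → ℂ, star e ⬝ᵥ e = 1 → star e' ⬝ᵥ e' = 1 → star e ⬝ᵥ e' = 0 →
      star e ⬝ᵥ (K *ᵥ e) = star e' ⬝ᵥ (K *ᵥ e')) {i i' : a} (hi : i ≠ i') :
    K i i = K i' i' ∧ K i i' = 0 := by
  have hii : ∀ x y : a, star (Pi.single x 1 : a → ℂ) ⬝ᵥ (Pi.single y 1 : a → ℂ) =
      if x = y then 1 else 0 := fun x y => by
    rw [← Pi.single_star, star_one, single_one_dotProduct, Pi.single_apply]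
  have hK : ∀ x y : a, star (Pi.single x 1 : a → ℂ) ⬝ᵥ (K *ᵥ (Pi.single y 1 : a → ℂ)) = K x y :=
    fun x y => by
    rw [← Pi.single_star, star_one, single_one_dotProduct, Matrix.mulVec_single_one]
    rfl
  obtain ⟨c, hc, hcc⟩ : ∃ c : ℂ, star c = c ∧ c * c = 2⁻¹ := by
    refine ⟨((Real.sqrt 2)⁻¹ : ℝ), Complex.conj_ofReal _, ?_⟩
    rw [← Complex.ofReal_mul, ← mul_inv, Real.mul_self_sqrt (by norm_num)]
    norm_num
  have hc0 : c ≠ 0 := by rintro rfl; norm_num at hcc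
  -- Compare the form on the orthonormal pair `(|i⟩ ± z|i'⟩)/√2`; the phases `z = 1` and `z = I`
  -- then isolate `K i i'`.
  have key : ∀ z : ℂ, star z * z = 1 → z * K i i' + star z * K i' i = 0 := fun z hz => by
    have := h (c • (Pi.single i 1 + z • Pi.single i' 1)) (c • (Pi.single i 1 - z • Pi.single i' 1))
      (by
        simp only [star_smul, star_add, hc, dotProduct_smul, smul_dotProduct, add_dotProduct,
          dotProduct_add, hii, hi, hi.symm, smul_eq_mul, if_true, if_false]
        linear_combination 2 * hcc + c * c * hz)
      (by
        simp only [star_smul, star_sub, hc, dotProduct_smul, smul_dotProduct, sub_dotProduct,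
          dotProduct_sub, hii, hi, hi.symm, smul_eq_mul, if_true, if_false]
        linear_combination 2 * hcc + c * c * hz)
      (by
        simp only [star_smul, star_add, hc, dotProduct_smul, smul_dotProduct, add_dotProduct,
          dotProduct_sub, hii, hi, hi.symm, smul_eq_mul, if_true, if_false]
        linear_combination -c * c * hz)
    simp only [star_smul, star_add, star_sub, hc, dotProduct_smul, smul_dotProduct, add_dotProduct,
      dotProduct_add, sub_dotProduct, dotProduct_sub, Matrix.mulVec_smul, Matrix.mulVec_add,
      Matrix.mulVec_sub, hK, smul_eq_mul] at this
    linear_combination this - 2 * (z * K i i' + star z * K i' i) * hcc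
  refine ⟨?_, ?_⟩
  · simpa only [hK] using h (Pi.single i 1) (Pi.single i' 1) (by simp [hii]) (by simp [hii])
      (by simp [hii, hi])
  · have h₁ := key 1 (by simp)
    have h₂ := key Complex.I (by simp)
    simp only [star_one, Complex.star_def, Complex.conj_I] at h₁ h₂
    have h₃ : 2 * Complex.I * K i i' = 0 := by linear_combination h₂ + Complex.I * h₁
    simpa using h₃

/-- Polarize twice. For fixed `f` and fixed entries on `B`, the form in `e` is scalar by
`scalar_of_orthonormal_pairs`. Letting `f` vary upgrades the resulting identities of quadratic forms
to identities of blocks. -/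
theorem EnvironmentBlind.decoupled [Nonempty a] {V : Matrix (A × B) (a × b) ℂ}
    (h : EnvironmentBlind V) : Decoupled V := by
  have key : ∀ {i i' : a}, i ≠ i' → (slice V i)ᴴ * slice V i = (slice V i')ᴴ * slice V i' ∧
      (slice V i)ᴴ * slice V i' = 0 := by
    intro i i' hi
    let block : B → B → a → a → Matrix b b ℂ := fun β β' p q j j' =>
      ((slice V p)ᴴ * slice V q) (β, j) (β', j')
    have hb : ∀ β β' f, star f ⬝ᵥ f = 1 →
        star f ⬝ᵥ (block β β' i i *ᵥ f) = star f ⬝ᵥ (block β β' i' i' *ᵥ f) ∧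
        star f ⬝ᵥ (block β β' i i' *ᵥ f) = 0 := fun β β' f hf => by
      refine scalar_of_orthonormal_pairs
        (K := fun p q => star f ⬝ᵥ (block β β' p q *ᵥ f)) (fun e e' he he' hee => ?_) hi
      have hq : ∀ e : a → ℂ,
          star e ⬝ᵥ (Matrix.of (fun p q => star f ⬝ᵥ (block β β' p q *ᵥ f)) *ᵥ e) =
            traceLeft (V * pureState (productVec e f) * Vᴴ) β' β := fun e => by
        rw [traceLeft_pureState_apply]
        simp only [Matrix.mulVec, dotProduct, Fintype.sum_prod_type, compression_single_apply,
          productVec, Pi.star_apply, star_mul', Finset.mul_sum, Finset.sum_mul, Matrix.of_apply,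
          block]
        refine Finset.sum_congr rfl fun p _ => ?_
        rw [Finset.sum_comm]
        refine Finset.sum_congr rfl fun j _ => Finset.sum_congr rfl fun q _ =>
          Finset.sum_congr rfl fun j' _ => ?_
        ring
      exact (hq e).trans ((congrFun (congrFun (h e e' f he he' hee hf) β') β).trans (hq e').symm)
    constructor
    · ext ⟨β, j⟩ ⟨β', j'⟩
      have : block β β' i i - block β β' i' i' = 0 := eq_zero_of_quadratic_form_unit fun f hf => by
        rw [Matrix.sub_mulVec, dotProduct_sub, (hb β β' f hf).1, sub_self]
      exact congrFun (congrFun (sub_eq_zero.1 this) j) j'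
    · ext ⟨β, j⟩ ⟨β', j'⟩
      have : block β β' i i' = 0 := eq_zero_of_quadratic_form_unit fun f hf => (hb β β' f hf).2
      exact congrFun (congrFun this j) j'
  obtain ⟨p⟩ := ‹Nonempty a›
  refine ⟨(slice V p)ᴴ * slice V p, fun i i' => ?_⟩
  split_ifs with hi
  · subst hi
    by_cases hp : i = p
    · rw [hp]
    · exact (key hp).1
  · exact (key hi).2

end Blind

/-! ### Entropic conditions make the environment blind. -/

section EntropyImpliesBlind

variable {A B a b : Type*} [Fintype A] [Fintype B] [Fintype a] [Fintype b]
  [DecidableEq A] [DecidableEq B] [DecidableEq a] [DecidableEq b]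

theorem IsCode.trace_conj {V : Matrix (A × B) (a × b) ℂ} (hV : IsCode V)
    (ρ : Matrix (a × b) (a × b) ℂ) : (V * ρ * Vᴴ).trace = ρ.trace := by
  rw [Matrix.trace_mul_comm, ← Matrix.mul_assoc, hV, Matrix.one_mul]

theorem IsDensity.swapFactors {ρ : Matrix (a × b) (a × b) ℂ} (hρ : IsDensity ρ) :
    IsDensity (swapFactors ρ) :=
  ⟨hρ.1.submatrix _, (trace_swapFactors _).trans hρ.2⟩

/-- Both product states reduce to `|f⟩⟨f|` on `b`, so the physical relative entropy is zero and
Klein's equality case applies. -/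
theorem RelativeEntropyEquality.environmentBlind {V : Matrix (A × B) (a × b) ℂ} (hV : IsCode V)
    (h : RelativeEntropyEquality V) : EnvironmentBlind V := by
  intro e e' f he he' _ hf
  have h₁ := isDensity_pureState_productVec he hf
  have h₂ := isDensity_pureState_productVec he' hf
  have := (h _ _ h₁ h₂).2
  rw [traceLeft_pureState_productVec, traceLeft_pureState_productVec, he, he',
    relativeEntropy_self] at this
  refine eq_of_relativeEntropy_eq_zero
    (posSemidef_traceLeft (h₁.1.mul_mul_conjTranspose_same V))
    (posSemidef_traceLeft (h₂.1.mul_mul_conjTranspose_same V)) ?_ this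
  rw [trace_traceLeft, trace_traceLeft, hV.trace_conj, hV.trace_conj, h₁.2, h₂.2]

theorem exists_unitary_with_columns {n κ : Type*} [Fintype n] [Fintype κ] [DecidableEq n]
    [DecidableEq κ] {E : Matrix n κ ℂ} (hE : Eᴴ * E = 1) :
    ∃ U ∈ Matrix.unitaryGroup n ℂ, ∃ g : κ ↪ n, ∀ x c, U x (g c) = E x c := by
  obtain ⟨g⟩ := Function.Embedding.nonempty_of_card_le (card_le_of_isometry hE)
  obtain ⟨U, hU, -, h⟩ := exists_unitary_extension rfl hE g.injective
  exact ⟨U, Matrix.mem_unitaryGroup_iff'.2 hU, g, h⟩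

theorem conj_diagonal_eq_sum_pureState {m n : Type*} [Fintype n] [DecidableEq n]
    (M : Matrix m n ℂ) (d : n → ℂ) :
    M * Matrix.diagonal d * Mᴴ = ∑ x, d x • Matrix.vecMulVec (M.col x) (star (M.col x)) := by
  ext y y'
  rw [Matrix.mul_apply, Matrix.sum_apply]
  refine Finset.sum_congr rfl fun x _ => ?_
  simp [Matrix.mul_diagonal, Matrix.vecMulVec_apply]
  ring

/-- All mixtures of `|ef⟩` and `|e'f⟩` reduce to `|f⟩⟨f|` on `b`, so the entropy on `B` is constant
along a segment; strict concavity makes its endpoints equal. -/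
theorem DiagonalEntropyFormula.environmentBlind {V : Matrix (A × B) (a × b) ℂ} (hV : IsCode V)
    (h : DiagonalEntropyFormula V) : EnvironmentBlind V := by
  intro e e' f he he' hee hf
  have hee' : star e' ⬝ᵥ e = 0 := by
    rw [← star_star (star e' ⬝ᵥ e), Matrix.star_dotProduct, star_star, hee, star_zero]
  -- Completing `e`, `e'` to one basis of `H_a` puts all the mixtures under a single pair of
  -- constants.
  obtain ⟨u, hu, g, hug⟩ := exists_unitary_with_columns
    (E := Matrix.of fun x (l : Fin 2) => ![e x, e' x] l) (by
      ext l l'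
      rw [Matrix.mul_apply]
      fin_cases l <;> fin_cases l'
      · simpa [dotProduct] using he
      · simpa [dotProduct] using hee
      · simpa [dotProduct] using hee'
      · simpa [dotProduct] using he')
  obtain ⟨w, hw, g', hwg⟩ := exists_unitary_with_columns
    (E := Matrix.of fun x (_ : Fin 1) => f x) (by
      ext l l'
      rw [Matrix.mul_apply, Subsingleton.elim l' l]
      simpa [dotProduct] using hf)
  set x : a × b := (g 0, g' 0)
  set x' : a × b := (g 1, g' 0)
  have hx : (u ⊗ₖ w).col x = productVec e f := by
    ext ⟨p, q⟩
    simp [x, productVec, Matrix.kroneckerMap_apply, hug, hwg]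
  have hx' : (u ⊗ₖ w).col x' = productVec e' f := by
    ext ⟨p, q⟩
    simp [x', productVec, Matrix.kroneckerMap_apply, hug, hwg]
  obtain ⟨LA, LB, hL, -⟩ := h u hu w hw
  have hmix : ∀ s t : ℝ, 0 ≤ s → 0 ≤ t → s + t = 1 →
      vonNeumannEntropy ((s : ℂ) • traceLeft (V * pureState (productVec e f) * Vᴴ) +
        (t : ℂ) • traceLeft (V * pureState (productVec e' f) * Vᴴ)) =
      LB + vonNeumannEntropy (pureState f) := fun s t hs ht hst => by
    have := (hL (Pi.single x s + Pi.single x' t)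
      (add_nonneg (a := (Pi.single x s : a × b → ℝ)) (Pi.single_nonneg.2 hs) (Pi.single_nonneg.2 ht))
      (by simp [Finset.sum_add_distrib, hst])).2
    have hρ : (u ⊗ₖ w) * Matrix.diagonal
        (fun y => (((Pi.single x s + Pi.single x' t : a × b → ℝ) y : ℝ) : ℂ)) * (u ⊗ₖ w)ᴴ =
        (s : ℂ) • pureState (productVec e f) + (t : ℂ) • pureState (productVec e' f) := by
      rw [conj_diagonal_eq_sum_pureState]
      simp only [Pi.add_apply, Complex.ofReal_add, add_smul, Finset.sum_add_distrib]
      rw [Finset.sum_eq_single x (fun y _ hy => by simp [hy]) (by simp),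
        Finset.sum_eq_single x' (fun y _ hy => by simp [hy]) (by simp), hx, hx',
        Pi.single_eq_same, Pi.single_eq_same]
      rfl
    rw [hρ, Matrix.mul_add, Matrix.add_mul, Matrix.mul_smul, Matrix.mul_smul, Matrix.smul_mul,
      Matrix.smul_mul, traceLeft_add, traceLeft_add, traceLeft_smul, traceLeft_smul,
      traceLeft_smul, traceLeft_smul, traceLeft_pureState_productVec,
      traceLeft_pureState_productVec, he, he', one_smul, ← add_smul] at this
    rw [this, ← Complex.ofReal_add, hst, Complex.ofReal_one, one_smul]
  have h₁ := isDensity_pureState_productVec he hf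
  have h₂ := isDensity_pureState_productVec he' hf
  refine eq_of_vonNeumannEntropy_midpoint
    (posSemidef_traceLeft (h₁.1.mul_mul_conjTranspose_same V))
    (posSemidef_traceLeft (h₂.1.mul_mul_conjTranspose_same V)) ?_ ?_
  · rw [trace_traceLeft, trace_traceLeft, hV.trace_conj, hV.trace_conj, h₁.2, h₂.2]
  · have e₁ := hmix 1 0 (by norm_num) (by norm_num) (by norm_num)
    have e₂ := hmix 0 1 (by norm_num) (by norm_num) (by norm_num)
    have e₃ := hmix 2⁻¹ 2⁻¹ (by norm_num) (by norm_num) (by norm_num)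
    simp only [Complex.ofReal_one, Complex.ofReal_zero, one_smul, zero_smul, add_zero,
      zero_add] at e₁ e₂
    rw [← smul_add, Complex.ofReal_inv, Complex.ofReal_ofNat] at e₃
    rw [e₁, e₂, e₃]
    ring

theorem RelativeEntropyEquality.swapFactors {V : Matrix (A × B) (a × b) ℂ}
    (h : RelativeEntropyEquality V) : RelativeEntropyEquality (swapFactors V) := by
  intro ρ σ hρ hσ
  have hs : ∀ τ : Matrix (b × a) (b × a) ℂ,
      Reconstruction.swapFactors V * τ * (Reconstruction.swapFactors V)ᴴ =
        Reconstruction.swapFactors (V * Reconstruction.swapFactors τ * Vᴴ) := fun τ => by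
    rw [swapFactors_mul, swapFactors_mul]
    rfl
  rw [hs, hs]
  exact (h _ _ hρ.swapFactors hσ.swapFactors).symm

theorem EntropyFormulas.swapFactors {V : Matrix (A × B) (a × b) ℂ} {LA LB : ℝ}
    {ρ : Matrix (a × b) (a × b) ℂ} (h : EntropyFormulas V LA LB ρ) :
    EntropyFormulas (swapFactors V) LB LA (swapFactors ρ) := by
  rw [EntropyFormulas, ← swapFactors_conjTranspose, ← swapFactors_mul, ← swapFactors_mul]
  exact h.symm

theorem DiagonalEntropyFormula.swapFactors {V : Matrix (A × B) (a × b) ℂ}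
    (h : DiagonalEntropyFormula V) : DiagonalEntropyFormula (swapFactors V) := by
  intro u hu w hw
  obtain ⟨LA, LB, hL, hLL⟩ := h w hw u hu
  refine ⟨LB, LA, fun p hp hp₁ => ?_, hLL.symm⟩
  have := (hL (fun x => p x.swap) (fun x => hp _)
    (((Equiv.prodComm a b).sum_comp p).trans hp₁)).swapFactors
  rw [swapFactors_mul, swapFactors_mul, swapFactors_conjTranspose, swapFactors_kronecker] at this
  convert this using 3
  exact (Matrix.submatrix_diagonal_equiv (fun x : a × b => (p x.swap : ℂ))
    (Equiv.prodComm b a)).symm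

theorem EntropyFormula.diagonal {V : Matrix (A × B) (a × b) ℂ} (h : EntropyFormula V) :
    DiagonalEntropyFormula V := by
  intro u hu w hw
  obtain ⟨LA, LB, hL, hLL⟩ := h
  refine ⟨LA, LB, fun p hp hp₁ => hL _ ⟨?_, ?_⟩, hLL⟩
  · exact (Matrix.PosSemidef.diagonal fun x => by simpa using hp x).mul_mul_conjTranspose_same _
  · have : (u ⊗ₖ w)ᴴ * (u ⊗ₖ w) = 1 := Matrix.mem_unitaryGroup_iff'.1
      (Matrix.kronecker_mem_unitary hu hw)
    rw [Matrix.trace_mul_comm, ← Matrix.mul_assoc, this, Matrix.one_mul, Matrix.trace_diagonal]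
    exact_mod_cast hp₁

end EntropyImpliesBlind

/-! ### The product form and its entropic consequences. -/

section ProductForm

variable {A B a b κ ι : Type*} [Fintype A] [Fintype B] [Fintype a] [Fintype b] [Fintype κ]
  [Fintype ι] [DecidableEq A] [DecidableEq B] [DecidableEq a] [DecidableEq b] [DecidableEq κ]
  [DecidableEq ι]

theorem trace_traceRight_mul (N : Matrix (A × B) (A × B) ℂ) (Z : Matrix A A ℂ) :
    (traceRight N * Z).trace = (N * (Z ⊗ₖ (1 : Matrix B B ℂ))).trace := by
  simp only [Matrix.trace, Matrix.diag_apply, Fintype.sum_prod_type, mul_kronecker_one_apply]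
  simp only [Matrix.mul_apply, traceRight, Finset.sum_mul]
  exact Finset.sum_congr rfl fun _ _ => Finset.sum_comm

theorem traceRight_kronecker_conj (P : Matrix A a ℂ) {Q : Matrix B b ℂ} (hQ : Qᴴ * Q = 1)
    (M : Matrix (a × b) (a × b) ℂ) :
    traceRight ((P ⊗ₖ Q) * M * (P ⊗ₖ Q)ᴴ) = P * traceRight M * Pᴴ := by
  -- By duality of the partial trace, testing against `Z ⊗ 1` lets `Qᴴ Q = 1` remove `Q`.
  rw [Matrix.ext_iff_trace_mul_right]
  intro Z
  have h : (P ⊗ₖ Q)ᴴ * (Z ⊗ₖ (1 : Matrix B B ℂ)) * (P ⊗ₖ Q) =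
      (Pᴴ * Z * P) ⊗ₖ (1 : Matrix b b ℂ) := by
    rw [Matrix.conjTranspose_kronecker, ← Matrix.mul_kronecker_mul, ← Matrix.mul_kronecker_mul,
      Matrix.mul_one, hQ]
  rw [trace_traceRight_mul, Matrix.mul_assoc, Matrix.mul_assoc, Matrix.trace_mul_comm,
    Matrix.mul_assoc, h, ← trace_traceRight_mul, Matrix.mul_assoc P, Matrix.mul_assoc P,
    Matrix.trace_mul_comm P]
  simp only [Matrix.mul_assoc]

/-- The map `|i⟩|j⟩ ↦ (|i⟩ ⊗ |j⟩) ⊗ ∑ k l, X k l |k⟩|l⟩`, with tensor factors rearranged. -/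
def attachVec (a b : Type*) {κ ι : Type*} [DecidableEq a] [DecidableEq b] (X : Matrix κ ι ℂ) :
    Matrix ((a × κ) × (b × ι)) (a × b) ℂ :=
  Matrix.of fun y x => if (y.1.1, y.2.1) = x then X y.1.2 y.2.2 else 0

theorem swapFactors_attachVec (X : Matrix κ ι ℂ) :
    swapFactors (attachVec a b X) = attachVec b a Xᵀ := by
  ext ⟨⟨j, l⟩, ⟨i, k⟩⟩ ⟨j', i'⟩
  simp [swapFactors_apply, attachVec, and_comm]

theorem traceRight_attachVec (X : Matrix κ ι ℂ) (ρ : Matrix (a × b) (a × b) ℂ) :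
    traceRight (attachVec a b X * ρ * (attachVec a b X)ᴴ) = traceRight ρ ⊗ₖ (X * Xᴴ) := by
  ext ⟨i, k⟩ ⟨i', k'⟩
  have h : ∀ y y', (attachVec a b X * ρ * (attachVec a b X)ᴴ) y y' =
      X y.1.2 y.2.2 * ρ (y.1.1, y.2.1) (y'.1.1, y'.2.1) * star (X y'.1.2 y'.2.2) := fun y y' => by
    simp only [Matrix.mul_apply, attachVec, Matrix.of_apply, Matrix.conjTranspose_apply, ite_mul,
      zero_mul, Finset.sum_ite_eq, Finset.mem_univ, if_true, apply_ite star, star_zero, mul_ite,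
      mul_zero]
  simp only [traceRight, h, Matrix.kroneckerMap_apply, Fintype.sum_prod_type, Matrix.mul_apply,
    Matrix.conjTranspose_apply, Finset.sum_mul_sum]
  exact Finset.sum_congr rfl fun j _ => Finset.sum_congr rfl fun l _ => by ring

/-- The code is a product of local isometries applied to the logical state and a fixed vector. -/
def IsProductForm (V : Matrix (A × B) (a × b) ℂ) (E : Matrix A (a × κ) ℂ) (F : Matrix B (b × ι) ℂ)
    (X : Matrix κ ι ℂ) : Prop :=
  Eᴴ * E = 1 ∧ Fᴴ * F = 1 ∧ V = (E ⊗ₖ F) * attachVec a b X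

theorem IsProductForm.swapFactors {V : Matrix (A × B) (a × b) ℂ} {E : Matrix A (a × κ) ℂ}
    {F : Matrix B (b × ι) ℂ} {X : Matrix κ ι ℂ} (h : IsProductForm V E F X) :
    IsProductForm (swapFactors V) F E Xᵀ := by
  refine ⟨h.2.1, h.1, ?_⟩
  rw [h.2.2, swapFactors_mul, swapFactors_kronecker, swapFactors_attachVec]

/-- `C` can be recovered from the single slice `p` as `(E p)ᴴ V_p`. The `B`-factorization of that
slice shows that `C` depends on `(β, j)` only through `F j`; the remaining coefficients form `X`. -/
theorem IsOrthogonalIsometries.exists_isProductForm [Nonempty a] {V : Matrix (A × B) (a × b) ℂ}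
    {E : a → Matrix A κ ℂ} {C : Matrix κ (B × b) ℂ} (hE : IsOrthogonalIsometries E)
    (hC : ∀ i, slice V i = E i * C) {F : b → Matrix B ι ℂ} {C' : Matrix ι (A × a) ℂ}
    (hF : IsOrthogonalIsometries F) (hC' : ∀ j, slice (swapFactors V) j = F j * C') :
    ∃ X : Matrix κ ι ℂ, IsProductForm V (Matrix.of fun α (x : a × κ) => E x.1 α x.2)
      (Matrix.of fun β (x : b × ι) => F x.1 β x.2) X := by
  obtain ⟨p⟩ := ‹Nonempty a›
  refine ⟨Matrix.of fun k l => ∑ α, star (E p α k) * C' l (α, p), hE.uncurry, hF.uncurry, ?_⟩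
  have hCp : ∀ k β j, C k (β, j) =
      ∑ l, F j β l * ∑ α, star (E p α k) * C' l (α, p) := fun k β j => by
    have h₁ : C = (E p)ᴴ * slice V p := by
      rw [hC, ← Matrix.mul_assoc, hE p p, if_pos rfl, Matrix.one_mul]
    have h₂ : ∀ α, slice V p α (β, j) = ∑ l, F j β l * C' l (α, p) := fun α => by
      rw [← Matrix.mul_apply, ← hC']
      rfl
    rw [h₁, Matrix.mul_apply]
    simp only [h₂, Matrix.conjTranspose_apply, Finset.mul_sum]
    rw [Finset.sum_comm]
    exact Finset.sum_congr rfl fun l _ => Finset.sum_congr rfl fun α _ => by ring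
  ext ⟨α, β⟩ ⟨i, j⟩
  have h₁ : V (α, β) (i, j) = ∑ k, E i α k * C k (β, j) := by
    exact congrFun (congrFun (hC i) α) (β, j)
  rw [h₁, Matrix.mul_apply]
  simp only [hCp, attachVec, Matrix.of_apply, Matrix.kroneckerMap_apply, Fintype.sum_prod_type,
    Prod.mk.injEq, mul_ite, mul_zero, ite_and, Finset.mul_sum]
  rw [Finset.sum_eq_single_of_mem i (Finset.mem_univ _) fun i' _ hi => by simp [hi]]
  refine Finset.sum_congr rfl fun k _ => ?_
  rw [Finset.sum_eq_single_of_mem j (Finset.mem_univ _) fun j' _ hj => by simp [hj]]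
  simp only [if_true]
  exact Finset.sum_congr rfl fun l _ => Finset.sum_congr rfl fun α' _ => by ring

theorem IsProductForm.traceRight_conj {V : Matrix (A × B) (a × b) ℂ} {E : Matrix A (a × κ) ℂ}
    {F : Matrix B (b × ι) ℂ} {X : Matrix κ ι ℂ} (h : IsProductForm V E F X)
    (ρ : Matrix (a × b) (a × b) ℂ) :
    traceRight (V * ρ * Vᴴ) = E * (traceRight ρ ⊗ₖ (X * Xᴴ)) * Eᴴ := by
  rw [← traceRight_attachVec, ← traceRight_kronecker_conj E h.2.1, h.2.2,
    Matrix.conjTranspose_mul]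
  simp only [Matrix.mul_assoc]

theorem IsProductForm.trace_eq_one {V : Matrix (A × B) (a × b) ℂ} (hV : IsCode V)
    {E : Matrix A (a × κ) ℂ} {F : Matrix B (b × ι) ℂ} {X : Matrix κ ι ℂ}
    (h : IsProductForm V E F X) {ρ : Matrix (a × b) (a × b) ℂ} (hρ : IsDensity ρ) :
    (X * Xᴴ).trace = 1 := by
  have h₁ := congrArg Matrix.trace (h.traceRight_conj ρ)
  rw [trace_traceRight, hV.trace_conj, Matrix.trace_mul_comm, ← Matrix.mul_assoc, h.1,
    Matrix.one_mul, Matrix.trace_kronecker, trace_traceRight, hρ.2, one_mul] at h₁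
  exact h₁.symm

theorem IsProductForm.vonNeumannEntropy_traceRight {V : Matrix (A × B) (a × b) ℂ} (hV : IsCode V)
    {E : Matrix A (a × κ) ℂ} {F : Matrix B (b × ι) ℂ} {X : Matrix κ ι ℂ}
    (h : IsProductForm V E F X) {ρ : Matrix (a × b) (a × b) ℂ} (hρ : IsDensity ρ) :
    vonNeumannEntropy (traceRight (V * ρ * Vᴴ)) =
      vonNeumannEntropy (X * Xᴴ) + vonNeumannEntropy (traceRight ρ) := by
  have h₁ := (posSemidef_traceRight hρ.1).1
  have h₂ := Matrix.isHermitian_mul_conjTranspose_self X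
  rw [h.traceRight_conj, vonNeumannEntropy_isometry _ h.1,
    vonNeumannEntropy_kronecker h₁ h₂ ((trace_traceRight ρ).trans hρ.2) (h.trace_eq_one hV hρ)]
  rw [Matrix.IsHermitian, Matrix.conjTranspose_kronecker, h₁, h₂]

theorem traceLeft_conj_eq (V : Matrix (A × B) (a × b) ℂ) (ρ : Matrix (a × b) (a × b) ℂ) :
    traceLeft (V * ρ * Vᴴ) =
      traceRight (swapFactors V * swapFactors ρ * (swapFactors V)ᴴ) := by
  rw [← traceRight_swapFactors, swapFactors_mul, swapFactors_mul]
  rfl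

theorem IsProductForm.entropyFormula {V : Matrix (A × B) (a × b) ℂ} (hV : IsCode V)
    {E : Matrix A (a × κ) ℂ} {F : Matrix B (b × ι) ℂ} {X : Matrix κ ι ℂ}
    (h : IsProductForm V E F X) : EntropyFormula V := by
  refine ⟨vonNeumannEntropy (X * Xᴴ), vonNeumannEntropy (Xᵀ * Xᵀᴴ),
    fun ρ hρ => ⟨h.vonNeumannEntropy_traceRight hV hρ, ?_⟩, ?_⟩
  · rw [traceLeft_conj_eq, h.swapFactors.vonNeumannEntropy_traceRight hV.swapFactors
      hρ.swapFactors, traceRight_swapFactors]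
  · have : Xᵀ * Xᵀᴴ = (Xᴴ * X)ᵀ := by rw [Matrix.transpose_mul]; rfl
    rw [this, vonNeumannEntropy_transpose (Matrix.isHermitian_conjTranspose_mul_self X),
      vonNeumannEntropy_mul_conjTranspose]

theorem kronecker_mulVec_productVec (P : Matrix A a ℂ) (Q : Matrix B b ℂ) (v : a → ℂ)
    (w : b → ℂ) : (P ⊗ₖ Q) *ᵥ productVec v w = productVec (P *ᵥ v) (Q *ᵥ w) := by
  ext ⟨α, β⟩
  simp only [Matrix.mulVec, dotProduct, productVec, Matrix.kroneckerMap_apply,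
    Fintype.sum_prod_type, Finset.sum_mul_sum]
  exact Finset.sum_congr rfl fun i _ => Finset.sum_congr rfl fun j _ => by ring

/-- Split off `1 ⊗ ω`, which is common to both sides, and apply `h` for each index of `κ`
separately. -/
theorem mulVec_kronecker_eq_zero {ρ σ : Matrix a a ℂ} {ω : Matrix κ κ ℂ}
    (h : ∀ v, σ *ᵥ v = 0 → ρ *ᵥ v = 0) (x : a × κ → ℂ) (hx : (σ ⊗ₖ ω) *ᵥ x = 0) :
    (ρ ⊗ₖ ω) *ᵥ x = 0 := by
  have hfac : ∀ τ : Matrix a a ℂ,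
      τ ⊗ₖ ω = (τ ⊗ₖ (1 : Matrix κ κ ℂ)) * ((1 : Matrix a a ℂ) ⊗ₖ ω) := fun τ => by
    rw [← Matrix.mul_kronecker_mul, Matrix.mul_one, Matrix.one_mul]
  rw [hfac, ← Matrix.mulVec_mulVec] at hx ⊢
  generalize ((1 : Matrix a a ℂ) ⊗ₖ ω) *ᵥ x = y at hx ⊢
  ext ⟨i, k⟩
  rw [kronecker_one_mulVec_apply]
  refine congrFun (h (fun i' => y (i', k)) ?_) i
  ext i'
  have := congrFun hx (i', k)
  rwa [kronecker_one_mulVec_apply] at this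

theorem ker_le_ker_kronecker_iff {ρ σ : Matrix a a ℂ} {ω : Matrix κ κ ℂ} (hω : ω ≠ 0)
    {E : Matrix A (a × κ) ℂ} (hE : Eᴴ * E = 1) :
    (∀ v, (E * (σ ⊗ₖ ω) * Eᴴ) *ᵥ v = 0 → (E * (ρ ⊗ₖ ω) * Eᴴ) *ᵥ v = 0) ↔
      ∀ v, σ *ᵥ v = 0 → ρ *ᵥ v = 0 := by
  have hz : ∀ (τ : Matrix (a × κ) (a × κ) ℂ) (v : A → ℂ),
      (E * τ * Eᴴ) *ᵥ v = 0 ↔ τ *ᵥ (Eᴴ *ᵥ v) = 0 := fun τ v => by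
    constructor
    · intro h
      have := congrArg (Eᴴ *ᵥ ·) h
      simpa only [Matrix.mulVec_mulVec, ← Matrix.mul_assoc, hE, Matrix.one_mul,
        Matrix.mulVec_zero] using this
    · intro h
      rw [Matrix.mul_assoc, ← Matrix.mulVec_mulVec, ← Matrix.mulVec_mulVec, h, Matrix.mulVec_zero]
  simp only [hz]
  constructor
  · intro h v hv
    -- Tensoring `v` with a vector outside the kernel of `ω` makes the kernel condition on the
    -- product visible on `v`.
    obtain ⟨w, hw⟩ : ∃ w, ω *ᵥ w ≠ 0 := by
      by_contra! hw
      exact hω (Matrix.mulVec_injective (funext fun w => by rw [hw w, Matrix.zero_mulVec]))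
    obtain ⟨k, hk⟩ := Function.ne_iff.1 hw
    have h₁ := h (E *ᵥ productVec v w)
    rw [Matrix.mulVec_mulVec (productVec v w), hE, Matrix.one_mulVec, kronecker_mulVec_productVec,
      kronecker_mulVec_productVec, hv] at h₁
    ext i
    have h₂ := congrFun (h₁ (by ext; simp [productVec])) (i, k)
    exact (mul_eq_zero.1 h₂).resolve_right hk
  · exact fun h v hv => mulVec_kronecker_eq_zero h _ hv

/-- The contribution of `ω` to both trace terms is the same and cancels; `ker_le_ker_kronecker_iff`
matches the infinite cases. -/
theorem relativeEntropy_kronecker_conj {ρ σ : Matrix a a ℂ} {ω : Matrix κ κ ℂ}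
    (hρ : ρ.IsHermitian) (hσ : σ.IsHermitian) (hω : ω.IsHermitian) (hω₁ : ω.trace = 1)
    {E : Matrix A (a × κ) ℂ} (hE : Eᴴ * E = 1) :
    relativeEntropy (E * (ρ ⊗ₖ ω) * Eᴴ) (E * (σ ⊗ₖ ω) * Eᴴ) = relativeEntropy ρ σ := by
  have hω₀ : ω ≠ 0 := by rintro rfl; simp at hω₁
  have hk : ∀ {τ : Matrix a a ℂ}, τ.IsHermitian → (τ ⊗ₖ ω).IsHermitian := fun hτ => by
    rw [Matrix.IsHermitian, Matrix.conjTranspose_kronecker, hτ, hω]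
  have ht : ∀ {τ : Matrix a a ℂ}, τ.IsHermitian → (∀ v, τ *ᵥ v = 0 → ρ *ᵥ v = 0) →
      (E * (ρ ⊗ₖ ω) * Eᴴ * matrixLog (E * (τ ⊗ₖ ω) * Eᴴ)).trace =
        (ρ * matrixLog τ).trace + ρ.trace * (ω * matrixLog ω).trace := fun {τ} hτ h => by
    rw [matrixLog_isometry (hk hτ) hE]
    have : E * (ρ ⊗ₖ ω) * Eᴴ * (E * matrixLog (τ ⊗ₖ ω) * Eᴴ) =
        E * ((ρ ⊗ₖ ω) * matrixLog (τ ⊗ₖ ω)) * Eᴴ := by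
      simp only [Matrix.mul_assoc]
      rw [← Matrix.mul_assoc Eᴴ E, hE, Matrix.one_mul]
    rw [this, Matrix.trace_mul_comm, ← Matrix.mul_assoc, hE, Matrix.one_mul,
      trace_mul_matrixLog_kronecker hτ hω h, hω₁, mul_one]
  have hker := ker_le_ker_kronecker_iff (ρ := ρ) (σ := σ) hω₀ hE
  rw [relativeEntropy, relativeEntropy]
  by_cases h : ∀ v, σ *ᵥ v = 0 → ρ *ᵥ v = 0
  · rw [if_pos h, if_pos (hker.2 h), ht hρ fun _ h => h, ht hσ h, Complex.add_re, Complex.add_re,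
      add_sub_add_right_eq_sub]
  · rw [if_neg h, if_neg (mt hker.1 h)]

theorem IsProductForm.relativeEntropy_traceRight {V : Matrix (A × B) (a × b) ℂ} (hV : IsCode V)
    {E : Matrix A (a × κ) ℂ} {F : Matrix B (b × ι) ℂ} {X : Matrix κ ι ℂ}
    (h : IsProductForm V E F X) {ρ σ : Matrix (a × b) (a × b) ℂ} (hρ : IsDensity ρ)
    (hσ : IsDensity σ) :
    relativeEntropy (traceRight (V * ρ * Vᴴ)) (traceRight (V * σ * Vᴴ)) =
      relativeEntropy (traceRight ρ) (traceRight σ) := by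
  rw [h.traceRight_conj, h.traceRight_conj]
  exact relativeEntropy_kronecker_conj (posSemidef_traceRight hρ.1).1
    (posSemidef_traceRight hσ.1).1 (Matrix.isHermitian_mul_conjTranspose_self X)
    (h.trace_eq_one hV hρ) h.1

theorem IsProductForm.relativeEntropyEquality {V : Matrix (A × B) (a × b) ℂ} (hV : IsCode V)
    {E : Matrix A (a × κ) ℂ} {F : Matrix B (b × ι) ℂ} {X : Matrix κ ι ℂ}
    (h : IsProductForm V E F X) : RelativeEntropyEquality V := by
  refine fun ρ σ hρ hσ => ⟨h.relativeEntropy_traceRight hV hρ hσ, ?_⟩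
  rw [traceLeft_conj_eq, traceLeft_conj_eq]
  exact h.swapFactors.relativeEntropy_traceRight hV.swapFactors hρ.swapFactors hσ.swapFactors

theorem BasisFactorization.exists_isProductForm [Nonempty a] {V : Matrix (A × B) (a × b) ℂ}
    {mA rA : ℕ} {DA : Matrix A ((a × Fin mA) ⊕ Fin rA) ℂ}
    {mB rB : ℕ} {DB : Matrix B ((b × Fin mB) ⊕ Fin rB) ℂ} (hDA : IsDecomposition DA)
    (hDB : IsDecomposition DB) (h : BasisFactorization V DA DB) :
    ∃ (E : Matrix A (a × Fin mA) ℂ) (F : Matrix B (b × Fin mB) ℂ) (X : Matrix (Fin mA) (Fin mB) ℂ),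
      IsProductForm V E F X := by
  obtain ⟨h₁, h₂⟩ := (basisFactorization_iff V DA DB).1 h
  obtain ⟨E, C, hE, hC⟩ := h₁.exists_isOrthogonalIsometries hDA
  obtain ⟨F, C', hF, hC'⟩ := h₂.exists_isOrthogonalIsometries hDB
  obtain ⟨X, hX⟩ := hE.exists_isProductForm hC hF hC'
  exact ⟨_, _, X, hX⟩

end ProductForm

/-! ### Passing between the two-sided conditions. -/

section Equivalence

variable {A B a b : Type*} [Fintype A] [Fintype B] [Fintype a] [Fintype b]
  [DecidableEq A] [DecidableEq B] [DecidableEq a] [DecidableEq b]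

theorem basisFactorization_of_decoupled [Nonempty a] [Nonempty b] {V : Matrix (A × B) (a × b) ℂ}
    (hV : IsCode V) {mA rA : ℕ} {DA : Matrix A ((a × Fin mA) ⊕ Fin rA) ℂ}
    {mB rB : ℕ} {DB : Matrix B ((b × Fin mB) ⊕ Fin rB) ℂ} (hDA : IsDecomposition DA)
    (hDB : IsDecomposition DB) (h₁ : Decoupled V) (h₂ : Decoupled (swapFactors V)) :
    BasisFactorization V DA DB :=
  (basisFactorization_iff V DA DB).2
    ⟨h₁.leftFactorization hV hDA, h₂.leftFactorization hV.swapFactors hDB⟩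

theorem BasisFactorization.operatorReconstruction {V : Matrix (A × B) (a × b) ℂ}
    (hV : IsCode V) {mA rA : ℕ} {DA : Matrix A ((a × Fin mA) ⊕ Fin rA) ℂ}
    {mB rB : ℕ} {DB : Matrix B ((b × Fin mB) ⊕ Fin rB) ℂ} (hDA : IsDecomposition DA)
    (hDB : IsDecomposition DB) (h : BasisFactorization V DA DB) : OperatorReconstruction V := by
  obtain ⟨h₁, h₂⟩ := (basisFactorization_iff V DA DB).1 h
  obtain ⟨E, C, hE, hC⟩ := h₁.exists_isOrthogonalIsometries hDA
  obtain ⟨F, C', hF, hC'⟩ := h₂.exists_isOrthogonalIsometries hDB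
  exact (operatorReconstruction_iff hV).2 ⟨hE.leftReconstruction hC, hF.leftReconstruction hC'⟩

theorem OperatorReconstruction.vanishingCommutators {V : Matrix (A × B) (a × b) ℂ}
    (hV : IsCode V) (h : OperatorReconstruction V) : VanishingCommutators V :=
  have h' := (operatorReconstruction_iff hV).1 h
  (vanishingCommutators_iff hV).2 ⟨h'.1.leftCommutes, h'.2.leftCommutes⟩

end Equivalence

end Reconstruction

end

open Reconstruction
theorem mainTheorem1 {A B a b : Type*} [Fintype A] [Fintype B] [Fintype a] [Fintype b]
    [DecidableEq A] [DecidableEq B] [DecidableEq a] [DecidableEq b]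
    [Nonempty a] [Nonempty b]
    (hA : Fintype.card a ≤ Fintype.card A) (hB : Fintype.card b ≤ Fintype.card B)
    (V : Matrix (A × B) (a × b) ℂ) (hV : IsCode V) :
    (∃ (m r : ℕ) (D : Matrix A ((a × Fin m) ⊕ Fin r) ℂ), IsDecomposition D) ∧
    (∃ (m r : ℕ) (D : Matrix B ((b × Fin m) ⊕ Fin r) ℂ), IsDecomposition D) ∧
    ∀ (mA rA : ℕ) (DA : Matrix A ((a × Fin mA) ⊕ Fin rA) ℂ)
      (mB rB : ℕ) (DB : Matrix B ((b × Fin mB) ⊕ Fin rB) ℂ),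
      IsDecomposition DA → IsDecomposition DB →
      List.TFAE
        [BasisFactorization V DA DB,
          EntropyFormula V,
          DiagonalEntropyFormula V,
          RelativeEntropyEquality V,
          VanishingCommutators V,
          OperatorReconstruction V] := by
  refine ⟨exists_isDecomposition, exists_isDecomposition, ?_⟩
  intro mA rA DA mB rB DB hDA hDB
  tfae_have 1 → 2 := fun h => by
    obtain ⟨E, F, X, hX⟩ := h.exists_isProductForm hDA hDB
    exact hX.entropyFormula hV
  tfae_have 2 → 3 := EntropyFormula.diagonal
  tfae_have 3 → 1 := fun h => basisFactorization_of_decoupled hV hDA hDB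
    (h.environmentBlind hV).decoupled (h.swapFactors.environmentBlind hV.swapFactors).decoupled
  tfae_have 1 → 4 := fun h => by
    obtain ⟨E, F, X, hX⟩ := h.exists_isProductForm hDA hDB
    exact hX.relativeEntropyEquality hV
  tfae_have 4 → 1 := fun h => basisFactorization_of_decoupled hV hDA hDB
    (h.environmentBlind hV).decoupled (h.swapFactors.environmentBlind hV.swapFactors).decoupled
  tfae_have 1 → 6 := fun h => h.operatorReconstruction hV hDA hDB
  tfae_have 6 → 5 := fun h => h.vanishingCommutators hV
  tfae_have 5 → 1 := fun h => by
    obtain ⟨h₁, h₂⟩ := (vanishingCommutators_iff hV).1 h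
    exact basisFactorization_of_decoupled hV hDA hDB h₁.decoupled h₂.decoupled
  tfae_finish
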